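/- Let $k$ be a field and let $n\ge 1$, $m\ge 3$ be integers. Paths are composed like maps, so $qp$ means $p$ followed by $q$. **The stable $n$-cubic pyramid algebra.** The stable $n$-cubic pyramid quiver $\tilde Q(n)$ of height $m$ has as vertices the integral vectors $\mathbf i=(i_1,\dots,i_n)$ with $i_t\ge 1$ for all $t$ and $\sum_{t=1}^{s} i_t\le m+s-1$ for $1\le s\le n$. With $\mathbf e_0=0$ put $\mathbf i(t)=\mathbf i-\mathbf e_{t-1}+\mathbf e_t$ for $1\le t\le n$ and $\mathbf i(n+1)=\mathbf i-\mathbf e_n$. For each $1\le t\le n+1$ and each vertex $\mathbf i$ such that $\mathbf i(t)$ is a vertex there is one arrow $\gamma_t^{\mathbf i}:\mathbf i\to\mathbf i(t)$, called of type $t$. A twist $\tilde{\mathbf g}$ consists of scalars $d_{s,t,\mathbf i}\in k$, for $1\le t<s\le n+1$, such that $d_{s,t,\mathbf i}\neq 0$ whenever $\mathbf i,\mathbf i(s),\mathbf i(t),\mathbf i(s)(t)$ are vertices, and such that each partial map $g_r:\gamma_t^{\mathbf i}\mapsto d_{r,t,\mathbf i}\,\gamma_t^{\mathbf i(r)}$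 ($t<r$) is compatible with the commutation relations of types smaller than $r$, that is, $$d_{s,t,\mathbf i}\,d_{r,t,\mathbf i(s)}\,d_{r,s,\mathbf i}=d_{r,s,\mathbf i(t)}\,d_{r,t,\mathbf i}\,d_{s,t,\mathbf i(r)}$$ for all $t<s<r$ and all $\mathbf i$ for which the eight vectors obtained from $\mathbf i$ by applying subsets of $\{t,s,r\}$ are vertices. The algebra $\tilde\Lambda(n)=\tilde\Lambda^{\tilde{\mathbf g}}(n)$ is $k\tilde Q(n)/(\tilde\rho)$, where $\tilde\rho$ consists of the elements $$d_{s,t,\mathbf i}\,\gamma_t^{\mathbf i(s)}\gamma_s^{\mathbf i}-\gamma_s^{\mathbf i(t)}\gamma_t^{\mathbf i}\quad(1\le t<s\le n+1,\ \ \mathbf i,\mathbf i(s),\mathbf i(t),\mathbf i(s)(t)\text{ vertices})$$ and of all paths $\gamma_t^{\mathbf i(t)}\gamma_t^{\mathbf i}$ ($1\le t\le n+1$). **$n$-translation quivers and algebras.** Let $(Q,\rho)$ be a bound quiver and $\Lambda=kQ/(\rho)$, graded by path length, $\Lambda=\bigoplus_t\Lambda_t$. An element of $kQ$ is bound if its image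 in $\Lambda$ is nonzero; a bound path is maximal if it is not a proper part of a longer bound path. $(Q,\rho)$ is an $n$-translation quiver with projective vertices $\mathcal P$, injective vertices $\mathcal I$ and $n$-translation a bijection $\tau:Q_0\setminus\mathcal P\to Q_0\setminus\mathcal I$ if (1) every maximal bound path has length $n+1$ and goes from $\tau i$ to $i$ for some $i\in Q_0\setminus\mathcal P$; (2) any two bound paths of length $n+1$ from $\tau i$ to $i$ are linearly dependent in $\Lambda$; (3) for $i\in Q_0\setminus\mathcal P$, $j\in Q_0$ and any bound linear combination $u$ of paths of the same length $t\le n+1$ from $j$ to $i$ there is a path $q$ of length $n+1-t$ from $\tau i$ to $j$ with $uq$ bound; (4) for $i\in Q_0\setminus\mathcal I$, $j\in Q_0$ and any bound linear combination $u$ of paths of the same length $t\le n+1$ from $i$ to $j$ there is a path $p$ of length $n+1-t$ from $j$ to $\tau^{-1}i$ with $pu$ bound. It is stable if $\mathcal P=\mathcal I=\emptyset$. $\Lambda$ is an $n$-translation algebra if $(Q,\rho)$ is an $n$-translation quiver and there is $q\in\mathbb N\cup\{\infty\}$ such that $\Lambda$ is $(n+1,q)$-Koszul: $\Lambda_t=0$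 for $t>n+1$, and for every vertex $i$ the first $q+1$ terms $P^q\xrightarrow{f_q}\cdots\to P^0\xrightarrow{f_0}S(i)\to 0$ of a minimal graded projective resolution of the simple left module $S(i)\simeq\Lambda_0e_i$ (in degree $0$) satisfy: $P^t$ is generated in degree $t$ for $0\le t\le q$, and, if $q$ is finite, $\ker f_q$ is concentrated in degree $n+1+q$. **Theorem.** $\tilde\Lambda(n)$ is an $n$-translation algebra; its $n$-translation quiver $(\tilde Q(n),\tilde\rho)$ is stable, and its $n$-translation is trivial, i.e. $\tau$ is the identity on the set of all vertices. -/

import Mathlib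

open scoped BigOperators

universe u v w

noncomputable section

/-! ### The path algebra of a quiver with finitely many vertices -/

/-- The path algebra `kQ`: the vector space with basis all paths (trivial paths included). -/
def PathAlgebra (k : Type u) (V : Type v) [Quiver.{w} V] [Field k] : Type (max u v w) :=
  (Σ i j : V, Quiver.Path i j) →₀ k

namespace PathAlgebra

variable (k : Type u) {V : Type v} [Quiver.{w} V] [Field k]

instance : AddCommGroup (PathAlgebra k V) :=
  inferInstanceAs (AddCommGroup ((Σ i j : V, Quiver.Path i j) →₀ k))

instance : Module k (PathAlgebra k V) :=
  inferInstanceAs (Module k ((Σ i j : V, Quiver.Path i j) →₀ k))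

/-- The basis of the path algebra that consists of all paths. -/
def basis : Module.Basis (Σ i j : V, Quiver.Path i j) k (PathAlgebra k V) :=
  Module.Basis.ofRepr (LinearEquiv.refl k ((Σ i j : V, Quiver.Path i j) →₀ k))

/-- A path as an element of the path algebra. -/
def ofPath {i j : V} (p : Quiver.Path i j) : PathAlgebra k V :=
  basis k ⟨i, j, p⟩

/-- The trivial path `e_i` at `i`. -/
def idem (i : V) : PathAlgebra k V := ofPath k (Quiver.Path.nil : Quiver.Path i i)

open scoped Classical in
/-- The product of two paths, written as composition of maps: `pathMul x y` is `y` followed by `x`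
if `x` starts where `y` ends, and `0` otherwise. -/
def pathMul (x y : Σ i j : V, Quiver.Path i j) : PathAlgebra k V :=
  if h : y.2.1 = x.1 then ofPath k (y.2.2.comp (x.2.2.cast h.symm rfl)) else 0

/-- The multiplication of the path algebra, as a bilinear map. -/
def mulHom : PathAlgebra k V →ₗ[k] PathAlgebra k V →ₗ[k] PathAlgebra k V :=
  (basis k).constr k (fun x => (basis k).constr k (fun y => pathMul k x y))

instance : Mul (PathAlgebra k V) := ⟨fun x y => mulHom k x y⟩

instance [Fintype V] : One (PathAlgebra k V) := ⟨∑ i : V, idem k i⟩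

variable {k}

theorem mul_def (x y : PathAlgebra k V) : x * y = mulHom k x y := rfl

theorem mulHom_ofPath {i j i' j' : V} (p : Quiver.Path i j) (q : Quiver.Path i' j') :
    mulHom k (ofPath k p) (ofPath k q) = pathMul k ⟨i, j, p⟩ ⟨i', j', q⟩ := by
  simp only [mulHom, ofPath, Module.Basis.constr_basis]

theorem ofPath_mul_ofPath {i j l : V} (p : Quiver.Path j l) (q : Quiver.Path i j) :
    ofPath k p * ofPath k q = ofPath k (q.comp p) := by
  rw [mul_def, mulHom_ofPath]
  simp [pathMul]

theorem ofPath_mul_ofPath_of_ne {i j i' j' : V} (p : Quiver.Path i j) (q : Quiver.Path i' j')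
    (h : j' ≠ i) : ofPath k p * ofPath k q = 0 := by
  rw [mul_def, mulHom_ofPath]
  simp [pathMul, h]

/-- Induction principle: a property closed under sums and scalars which holds for paths. -/
theorem induction {P : PathAlgebra k V → Prop} (x : PathAlgebra k V) (h0 : P 0)
    (ha : ∀ x y, P x → P y → P (x + y)) (hs : ∀ (c : k) x, P x → P (c • x))
    (hp : ∀ {i j : V} (p : Quiver.Path i j), P (ofPath k p)) : P x := by
  have hx : x ∈ Submodule.span k (Set.range (basis k (V := V))) := by
    rw [Module.Basis.span_eq]
    trivial
  induction hx using Submodule.span_induction with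
  | mem x h =>
    obtain ⟨⟨i, j, p⟩, rfl⟩ := h
    exact hp p
  | zero => exact h0
  | add x y _ _ hx hy => exact ha x y hx hy
  | smul c x _ hx => exact hs c x hx

theorem mul_add' (x y z : PathAlgebra k V) : x * (y + z) = x * y + x * z := by
  simp [mul_def]

theorem add_mul' (x y z : PathAlgebra k V) : (x + y) * z = x * z + y * z := by
  simp [mul_def]

theorem smul_mul' (c : k) (x y : PathAlgebra k V) : (c • x) * y = c • (x * y) := by
  simp [mul_def]

theorem mul_smul' (c : k) (x y : PathAlgebra k V) : x * (c • y) = c • (x * y) := by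
  simp [mul_def]

theorem zero_mul' (x : PathAlgebra k V) : 0 * x = 0 := by simp [mul_def]

theorem mul_zero' (x : PathAlgebra k V) : x * 0 = 0 := by simp [mul_def]

theorem mul_assoc' (x y z : PathAlgebra k V) : x * y * z = x * (y * z) := by
  induction x using PathAlgebra.induction with
  | h0 => simp only [zero_mul']
  | ha a b iha ihb => simp only [add_mul', iha, ihb]
  | hs c a ih => simp only [smul_mul', ih]
  | @hp i j p =>
  induction y using PathAlgebra.induction with
  | h0 => simp only [zero_mul', mul_zero']
  | ha a b iha ihb => simp only [add_mul', mul_add', iha, ihb]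
  | hs c a ih => simp only [smul_mul', mul_smul', ih]
  | @hp i' j' q =>
  induction z using PathAlgebra.induction with
  | h0 => simp only [mul_zero']
  | ha a b iha ihb => simp only [mul_add', iha, ihb]
  | hs c a ih => simp only [mul_smul', ih]
  | @hp i'' j'' r =>
  by_cases h : j' = i
  · subst h
    by_cases h' : j'' = i'
    · subst h'
      simp only [ofPath_mul_ofPath, Quiver.Path.comp_assoc]
    · simp only [ofPath_mul_ofPath, ofPath_mul_ofPath_of_ne _ _ h', mul_zero']
  · by_cases h' : j'' = i'
    · subst h'
      simp only [ofPath_mul_ofPath, ofPath_mul_ofPath_of_ne _ _ h, zero_mul']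
    · simp only [ofPath_mul_ofPath_of_ne _ _ h, ofPath_mul_ofPath_of_ne _ _ h', zero_mul',
        mul_zero']

theorem one_def [Fintype V] : (1 : PathAlgebra k V) = ∑ i : V, idem k i := rfl

theorem one_mul' [Fintype V] (x : PathAlgebra k V) : 1 * x = x := by
  induction x using PathAlgebra.induction with
  | h0 => simp only [mul_zero']
  | ha a b iha ihb => simp only [mul_add', iha, ihb]
  | hs c a ih => simp only [mul_smul', ih]
  | @hp i j p =>
  rw [one_def, mul_def, map_sum, LinearMap.sum_apply, Finset.sum_eq_single j]
  · exact (ofPath_mul_ofPath _ _).trans (by simp)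
  · intro b _ hb
    exact ofPath_mul_ofPath_of_ne _ _ hb.symm
  · simp

theorem mul_one' [Fintype V] (x : PathAlgebra k V) : x * 1 = x := by
  induction x using PathAlgebra.induction with
  | h0 => simp only [zero_mul']
  | ha a b iha ihb => simp only [add_mul', iha, ihb]
  | hs c a ih => simp only [smul_mul', ih]
  | @hp i j p =>
  rw [one_def, mul_def, map_sum, Finset.sum_eq_single i]
  · exact (ofPath_mul_ofPath _ _).trans (by simp)
  · intro b _ hb
    exact ofPath_mul_ofPath_of_ne _ _ hb
  · simp

instance [Fintype V] : Ring (PathAlgebra k V) :=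
  { (inferInstance : AddCommGroup (PathAlgebra k V)) with
    mul := (· * ·)
    one := 1
    left_distrib := mul_add'
    right_distrib := add_mul'
    zero_mul := zero_mul'
    mul_zero := mul_zero'
    mul_assoc := mul_assoc'
    one_mul := one_mul'
    mul_one := mul_one' }

instance [Fintype V] : Algebra k (PathAlgebra k V) :=
  Algebra.ofModule smul_mul' mul_smul'

end PathAlgebra

/-! ### Bound quivers -/

section BoundQuiver

variable {k : Type u} {V : Type v} [Quiver.{w} V] [Field k] [Fintype V]

/-- The algebra `kQ/(ρ)` of the bound quiver `(Q, ρ)`. -/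
abbrev BoundAlgebra (ρ : Set (PathAlgebra k V)) : Type (max u v w) :=
  RingQuot (fun a b : PathAlgebra k V => a ∈ ρ ∧ b = 0)

/-- The projection `kQ → kQ/(ρ)`. -/
def toBound (ρ : Set (PathAlgebra k V)) : PathAlgebra k V →ₐ[k] BoundAlgebra ρ :=
  RingQuot.mkAlgHom k (fun a b : PathAlgebra k V => a ∈ ρ ∧ b = 0)

/-- An element of `kQ` is bound if its image in `kQ/(ρ)` is nonzero. -/
def IsBound (ρ : Set (PathAlgebra k V)) (x : PathAlgebra k V) : Prop :=
  toBound ρ x ≠ 0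

/-- The linear combinations of paths of length `t` from `i` to `j`. -/
def pathSpan (k : Type u) {V : Type v} [Quiver.{w} V] [Field k] (i j : V) (t : ℕ) :
    Submodule k (PathAlgebra k V) :=
  Submodule.span k {x | ∃ p : Quiver.Path i j, p.length = t ∧ x = PathAlgebra.ofPath k p}

/-- A bound path which is not a proper part of a longer bound path. -/
def IsMaximalBoundPath (ρ : Set (PathAlgebra k V)) {i j : V} (p : Quiver.Path i j) : Prop :=
  IsBound ρ (PathAlgebra.ofPath k p) ∧
    ∀ (i' j' : V) (q : Quiver.Path i' i) (r : Quiver.Path j j'),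
      IsBound ρ (PathAlgebra.ofPath k ((q.comp p).comp r)) → q.length = 0 ∧ r.length = 0

/-- `(Q, ρ)` is an `n`-translation quiver with projective vertices `P`, injective vertices `I` and
`n`-translation `τ : Q₀ \ P → Q₀ \ I`. Products are composed like maps, so `u * q` is `q`
followed by `u`. -/
structure IsTranslationQuiver (n : ℕ) (ρ : Set (PathAlgebra k V)) (P I : Set V)
    (τ : (Pᶜ : Set V) ≃ (Iᶜ : Set V)) : Prop where
  maximal : ∀ (i j : V) (p : Quiver.Path i j), IsMaximalBoundPath ρ p →
    p.length = n + 1 ∧ ∃ x : (Pᶜ : Set V), (x : V) = j ∧ (τ x : V) = i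
  dependent : ∀ (x : (Pᶜ : Set V)) (p q : Quiver.Path (τ x : V) (x : V)),
    p.length = n + 1 → q.length = n + 1 →
    IsBound ρ (PathAlgebra.ofPath k p) → IsBound ρ (PathAlgebra.ofPath k q) →
    ¬ LinearIndependent k
      ![toBound ρ (PathAlgebra.ofPath k p), toBound ρ (PathAlgebra.ofPath k q)]
  extend_right : ∀ (x : (Pᶜ : Set V)) (j : V) (t : ℕ), t ≤ n + 1 →
    ∀ y ∈ pathSpan k j (x : V) t, IsBound ρ y →
      ∃ q : Quiver.Path (τ x : V) j, q.length = n + 1 - t ∧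
        IsBound ρ (y * PathAlgebra.ofPath k q)
  extend_left : ∀ (x : (Iᶜ : Set V)) (j : V) (t : ℕ), t ≤ n + 1 →
    ∀ y ∈ pathSpan k (x : V) j t, IsBound ρ y →
      ∃ p : Quiver.Path j (τ.symm x : V), p.length = n + 1 - t ∧
        IsBound ρ (PathAlgebra.ofPath k p * y)

/-! ### The length grading, simple modules and almost Koszul algebras -/

/-- The degree `t` part `Λ_t` of `Λ = kQ/(ρ)`: the span of the images of the paths of length
`t`. -/
def degreePart (ρ : Set (PathAlgebra k V)) (t : ℕ) : Submodule k (BoundAlgebra ρ) :=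
  Submodule.span k
    {x | ∃ (i j : V) (p : Quiver.Path i j), p.length = t ∧ x = toBound ρ (PathAlgebra.ofPath k p)}

/-- The idempotent `e_i` of `Λ`. -/
def boundIdem (ρ : Set (PathAlgebra k V)) (i : V) : BoundAlgebra ρ :=
  toBound ρ (PathAlgebra.idem k i)

/-- `r M = Λ_{≥ 1} M`, the submodule of a left `Λ`-module `M` generated by all `α x` with
`α ∈ Λ_1`. -/
def radPart (ρ : Set (PathAlgebra k V)) (M : Type*) [AddCommGroup M] [Module (BoundAlgebra ρ) M] :
    Submodule (BoundAlgebra ρ) M :=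
  Submodule.span (BoundAlgebra ρ) {y | ∃ a ∈ degreePart ρ 1, ∃ x : M, y = a • x}

/-- The left ideal `Λ e_i`, spanned by the paths starting at `i`. -/
abbrev projAt (ρ : Set (PathAlgebra k V)) (i : V) : Submodule (BoundAlgebra ρ) (BoundAlgebra ρ) :=
  Submodule.span (BoundAlgebra ρ) {boundIdem ρ i}

/-- The simple module `S(i) = Λ e_i / r e_i`, isomorphic to `Λ_0 e_i`. -/
abbrev simpleAt (ρ : Set (PathAlgebra k V)) (i : V) : Type (max u v w) :=
  projAt ρ i ⧸ radPart ρ (projAt ρ i)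

/-- The terms `P^q → ⋯ → P^1 → P^0 → S(i) → 0` of a graded complex of left `Λ`-modules; `f t` is
the map `P^{t+1} → P^t`, `ε` is the map `P^0 → S(i)`, and `deg t d` is the degree `d` part of
`P^t`. For finite `q` the data with index beyond `q` play no role. -/
structure ResolutionData (ρ : Set (PathAlgebra k V)) (i : V) where
  P : ℕ → Type (max u v w)
  [grp : ∀ t, AddCommGroup (P t)]
  [mod : ∀ t, Module (BoundAlgebra ρ) (P t)]
  deg : ∀ t, ℕ → AddSubgroup (P t)
  ε : P 0 →ₗ[BoundAlgebra ρ] simpleAt ρ i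
  f : ∀ t, P (t + 1) →ₗ[BoundAlgebra ρ] P t

attribute [instance] ResolutionData.grp ResolutionData.mod

/-- The kernel of the map that leaves `P^t`. -/
def ResolutionData.kernel {ρ : Set (PathAlgebra k V)} {i : V} (R : ResolutionData ρ i) :
    ∀ t, Submodule (BoundAlgebra ρ) (R.P t)
  | 0 => LinearMap.ker R.ε
  | t + 1 => LinearMap.ker (R.f t)

/-- The data form the first `q + 1` terms of a minimal graded projective resolution of `S(i)`
(of all of it if `q = ∞`), where `S(i)` sits in degree `0`. -/
structure ResolutionData.IsMinimalResolution {ρ : Set (PathAlgebra k V)} {i : V}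
    (R : ResolutionData ρ i) (q : ℕ∞) : Prop where
  projective : ∀ t : ℕ, (t : ℕ∞) ≤ q → Module.Projective (BoundAlgebra ρ) (R.P t)
  graded : ∀ t : ℕ, (t : ℕ∞) ≤ q → DirectSum.IsInternal (R.deg t)
  graded_smul : ∀ t : ℕ, (t : ℕ∞) ≤ q → ∀ (c d : ℕ), ∀ a ∈ degreePart ρ c, ∀ x ∈ R.deg t d,
    a • x ∈ R.deg t (c + d)
  graded_aug : ∀ d : ℕ, d ≠ 0 → ∀ x ∈ R.deg 0 d, R.ε x = 0
  graded_map : ∀ t : ℕ, ((t + 1 : ℕ) : ℕ∞) ≤ q → ∀ d : ℕ, ∀ x ∈ R.deg (t + 1) d,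
    R.f t x ∈ R.deg t d
  surjective : Function.Surjective R.ε
  exact : ∀ t : ℕ, ((t + 1 : ℕ) : ℕ∞) ≤ q → LinearMap.range (R.f t) = R.kernel t
  minimal : ∀ t : ℕ, (t : ℕ∞) ≤ q → R.kernel t ≤ radPart ρ (R.P t)

/-- `Λ = kQ/(ρ)` is `(p, q)`-Koszul: `Λ_t = 0` for `t > p`, and the first `q + 1` terms `P^t` of a
minimal graded projective resolution of each simple `S(i)` are generated in degree `t`, with the
kernel of the last map `f_q` concentrated in degree `p + q` (no condition if `q = ∞`). -/
def IsKoszulOfType (ρ : Set (PathAlgebra k V)) (p : ℕ) (q : ℕ∞) : Prop :=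
  (∀ t : ℕ, p < t → degreePart ρ t = ⊥) ∧
    ∀ i : V, ∃ R : ResolutionData ρ i, R.IsMinimalResolution q ∧
      (∀ t : ℕ, (t : ℕ∞) ≤ q →
        Submodule.span (BoundAlgebra ρ) (R.deg t t : Set (R.P t)) = ⊤) ∧
      (∀ q' : ℕ, q = (q' : ℕ∞) → ∀ x ∈ R.kernel q', x ∈ R.deg q' (p + q'))

/-- `kQ/(ρ)` is an `n`-translation algebra whose `n`-translation quiver is `(Q, ρ)` with projective
vertices `P`, injective vertices `I` and `n`-translation `τ`. -/
def IsTranslationAlgebra (n : ℕ) (ρ : Set (PathAlgebra k V)) (P I : Set V)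
    (τ : (Pᶜ : Set V) ≃ (Iᶜ : Set V)) : Prop :=
  IsTranslationQuiver n ρ P I τ ∧ ∃ q : ℕ∞, IsKoszulOfType ρ (n + 1) q

end BoundQuiver

/-! ### The stable `n`-cubic pyramid quiver of height `m` -/

/-- The vertex condition: `1 ≤ i_t` for all `t` and `i_1 + ⋯ + i_s ≤ m + s - 1` for
`1 ≤ s ≤ n`. The index `s : Fin n` stands for `s + 1`. -/
def IsPyramidVertex (n m : ℕ) (i : Fin n → ℤ) : Prop :=
  (∀ t, 1 ≤ i t) ∧ ∀ s : Fin n, ∑ t ∈ Finset.univ.filter (fun t => t ≤ s), i t ≤ (m : ℤ) + (s : ℤ)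

/-- The vertices of the (stable) `n`-cubic pyramid quiver of height `m`. -/
def PyramidVertex (n m : ℕ) : Type := {i : Fin n → ℤ // IsPyramidVertex n m i}

/-- The displacement `e_t - e_{t-1}` of an arrow of type `t`, where `e_0 = 0`, for `1 ≤ t ≤ n`, and
`-e_n` for the type `t = n + 1`. The type `t : Fin (n + 1)` stands for `t + 1`. -/
def pyramidStep (n : ℕ) (t : Fin (n + 1)) : Fin n → ℤ := fun s =>
  (if (s : ℕ) = (t : ℕ) then 1 else 0) - (if (s : ℕ) + 1 = (t : ℕ) then 1 else 0)

theorem pyramidVertex_finite (n m : ℕ) : Finite (PyramidVertex n m) := by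
  refine Set.Finite.subset (Set.finite_Icc (fun _ : Fin n => (1 : ℤ)) (fun _ => (m : ℤ) + n)) ?_
  rintro i ⟨h1, h2⟩
  refine ⟨fun t => h1 t, fun t => ?_⟩
  have h3 : i t ≤ ∑ s ∈ Finset.univ.filter (fun s => s ≤ t), i s :=
    Finset.single_le_sum (f := i) (fun s _ => le_trans zero_le_one (h1 s)) (by simp)
  have h4 := h2 t
  have h5 := t.isLt
  show i t ≤ (m : ℤ) + n
  omega

instance (n m : ℕ) : Fintype (PyramidVertex n m) :=
  @Fintype.ofFinite _ (pyramidVertex_finite n m)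

/-- The stable quiver: the arrows `i → j` of type `t`, for `1 ≤ t ≤ n + 1`, exist (and are then
unique) when `j = i + e_t - e_{t-1}`, respectively `j = i - e_n` if `t = n + 1`. -/
instance (n m : ℕ) : Quiver.{0} (PyramidVertex n m) where
  Hom i j := {t : Fin (n + 1) // j.1 = i.1 + pyramidStep n t}

/-- The type of an arrow. -/
def arrowType {n m : ℕ} {i j : PyramidVertex n m} (a : i ⟶ j) : Fin (n + 1) := Subtype.val a

section StableAlgebra

variable {k : Type u} [Field k] {n m : ℕ}

/-- The twist `g̃ = (g_1, …, g_{n+1})`, given by the scalars `d s t i = d_{s,t,i}` with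
`g_s (γ_t^i) = d_{s,t,i} γ_t^{i(s)}` for `t < s`, where `i(s) = i + e_s - e_{s-1}` is the translate
of `i`. The scalars are nonzero, and each `g_r` is compatible with the commutation relations of
the types `t < s < r`: it carries `d_{s,t,i} γ_t γ_s - γ_s γ_t` at `i` to a multiple of the
relation at `i(r)`. Only vertices of the quiver are involved. -/
structure IsPyramidTwist (n m : ℕ)
    (d : Fin (n + 1) → Fin (n + 1) → (Fin n → ℤ) → k) : Prop where
  ne_zero : ∀ (s t : Fin (n + 1)) (i : Fin n → ℤ), t < s →
    IsPyramidVertex n m i →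
    IsPyramidVertex n m (i + pyramidStep n s) →
    IsPyramidVertex n m (i + pyramidStep n t) →
    IsPyramidVertex n m (i + pyramidStep n s + pyramidStep n t) → d s t i ≠ 0
  compatible : ∀ (r s t : Fin (n + 1)) (i : Fin n → ℤ), t < s → s < r →
    (∀ J : Finset (Fin (n + 1)), J ⊆ {r, s, t} →
      IsPyramidVertex n m (i + ∑ x ∈ J, pyramidStep n x)) →
    d s t i * d r t (i + pyramidStep n s) * d r s i =
      d r s (i + pyramidStep n t) * d r t i * d s t (i + pyramidStep n r)

/-- The relations of the stable pyramid algebra: `d_{s,t,i} γ_t γ_s - γ_s γ_t` for `t < s` on each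
square `i, i(s), i(t), i(s)(t)` of vertices, and `γ_t γ_t = 0`. -/
def stableRelations (d : Fin (n + 1) → Fin (n + 1) → (Fin n → ℤ) → k) :
    Set (PathAlgebra k (PyramidVertex n m)) :=
  {x | ∃ (i j j' l : PyramidVertex n m) (a : i ⟶ j) (b : j ⟶ l) (a' : i ⟶ j') (b' : j' ⟶ l),
      arrowType b = arrowType a' ∧ arrowType b' = arrowType a ∧ arrowType a' < arrowType a ∧
      x = d (arrowType a) (arrowType a') i.1 • PathAlgebra.ofPath k (a.toPath.comp b.toPath)
        - PathAlgebra.ofPath k (a'.toPath.comp b'.toPath)} ∪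
  {x | ∃ (i j l : PyramidVertex n m) (a : i ⟶ j) (b : j ⟶ l),
      arrowType b = arrowType a ∧ x = PathAlgebra.ofPath k (a.toPath.comp b.toPath)}

end StableAlgebra

end

/-! A vertex is a distribution of `m - 1` tokens on a cycle of `n + 1` places, and an arrow of type
`t` moves a token from place `t` to place `t + 1`. This turns every question about which vertices
exist into one about nonnegative token counts.

The twist can be removed. Rescaling the arrows by suitable units (`exists_gauge`) turns the
relations into plain commutativity and `γ_t γ_t = 0`. The compatibility of the twist is exactly the
cocycle condition needed to construct the units one type after another. Then the product of rescaled
arrows along a path from `i` depends only on the set `J` of types used (`nonempty_pyramidFrame`). It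
vanishes once a type repeats, even if the repeated arrows are not adjacent
(`PyramidFrame.gen_mul_b_of_mem`, where at least two tokens are needed). So the elements `b i J`
with legal endpoint span `Λ e_i`. They are nonzero because they act as expected on an explicit
module with basis the sets `J` (`CubeModule`). The full set of types leads back to the start, so
maximal bound paths are closed of length `n + 1`. Complementary sets multiply to the full one, and
`J` is determined by its cardinality and the two endpoints. The translation quiver axioms with
trivial translation follow.

For almost Koszulity, the resolution of `S(i)` has in step `t` the summands `Λ e_j` labelled by
exponents `z` of total degree `t`, with `z s` at most the number of tokens of `i` at place `s`. Here
`j` is `i` displaced by `z`. Its basis consists of pairs `(z, J)`, and the differential moves one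
unit of `z` into `J`, with signs. If legality of endpoints is ignored, this is a tensor product over
the places `s` of truncated resolutions of `k` over `k[x]/(x²)`. The differential preserves the
multidegree `w`, the sum of `z` and the indicator of `J`. A place with `1 ≤ w s ≤ T s`, where `T s`
is its token count, gives a contracting homotopy (`BoxModule.eq_diff_homotopy`). If there is no such
place, each `s` has either `z s = 0` and `s ∉ J`, or `z s = T s` and `s ∈ J`. Legality of the
endpoint forces the same alternative all around the cycle (`BoxModule.eq_or_eq_of_not_isFree`). One
alternative is `S(i)` itself. The other sits in step `∑ T s = m - 1` with `J` full, hence in degree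
`(n + 1) + (m - 1)`. Thus `Λ` is `(n + 1, m - 1)`-Koszul. -/

noncomputable section

/-! ### Vertices as token distributions on a cycle -/

section Tokens

variable {n m : ℕ}

/-- The change of the token numbers under a displacement. -/
def tokenShift (n : ℕ) : (Fin n → ℤ) →+ (Fin (n + 1) → ℤ) where
  toFun v := Fin.cons (-∑ s, v s) v
  map_zero' := by
    ext t
    cases t using Fin.cases <;> simp
  map_add' v w := by
    ext t
    cases t using Fin.cases
    · simp [Finset.sum_add_distrib]; ring
    · simp

/-- A vertex of the pyramid is a distribution of `m - 1` tokens on a cycle of length `n + 1`;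
an arrow of type `t` moves a token from place `t` to place `t + 1`. -/
def tokens (n m : ℕ) (i : Fin n → ℤ) : Fin (n + 1) → ℤ :=
  Fin.cons ((m : ℤ) - 1 - ∑ s, (i s - 1)) (fun s => i s - 1)

theorem tokens_add (i v : Fin n → ℤ) : tokens n m (i + v) = tokens n m i + tokenShift n v := by
  ext t
  cases t using Fin.cases
  · simp [tokens, tokenShift, Finset.sum_add_distrib]; ring
  · simp [tokens, tokenShift]; ring

theorem tokenShift_injective : Function.Injective (tokenShift n) := by
  intro v w h
  ext s
  simpa [tokenShift] using congrFun h s.succ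

theorem tokenShift_step (hn : 1 ≤ n) (t u : Fin (n + 1)) :
    tokenShift n (pyramidStep n t) u = (if u = t + 1 then 1 else 0) - (if u = t then 1 else 0) := by
  -- Successors in `Fin (n + 1)` wrap around exactly at the last type, which returns a token to
  -- place `0`.
  have key : ((t : ℕ) = n ∧ ((t + 1 : Fin (n + 1)) : ℕ) = 0) ∨
      ((t : ℕ) ≠ n ∧ ((t + 1 : Fin (n + 1)) : ℕ) = t + 1) := by
    rw [Fin.val_add_one]
    by_cases h : t = Fin.last n
    · exact Or.inl ⟨by rw [h]; rfl, if_pos h⟩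
    · exact Or.inr ⟨fun h' => h (Fin.ext h'), if_neg h⟩
  have htn := t.isLt
  cases u using Fin.cases with
  | zero =>
    have h1 : ∑ s : Fin n, (if (s : ℕ) = (t : ℕ) then (1 : ℤ) else 0)
        = if (t : ℕ) = n then 0 else 1 := by
      split_ifs with h
      · refine Finset.sum_eq_zero fun s _ => if_neg ?_
        have := s.isLt
        omega
      · have ht : (t : ℕ) < n := by have := t.isLt; omega
        rw [Finset.sum_eq_single ⟨t, ht⟩]
        · simp
        · intro b _ hb
          exact if_neg fun h' => hb (Fin.ext h')
        · simp
    have h2 : ∑ s : Fin n, (if (s : ℕ) + 1 = (t : ℕ) then (1 : ℤ) else 0)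
        = if (t : ℕ) = 0 then 0 else 1 := by
      split_ifs with h
      · exact Finset.sum_eq_zero fun s _ => if_neg (by omega)
      · have ht : (t : ℕ) - 1 < n := by have := t.isLt; omega
        rw [Finset.sum_eq_single ⟨t - 1, ht⟩]
        · simp; omega
        · intro b _ hb
          refine if_neg fun h' => hb (Fin.ext ?_)
          simp; omega
        · simp
    simp only [tokenShift, AddMonoidHom.coe_mk, ZeroHom.coe_mk, Fin.cons_zero, pyramidStep,
      Finset.sum_sub_distrib, h1, h2, Fin.ext_iff, Fin.val_zero]
    rcases key with ⟨h, key⟩ | ⟨h, key⟩ <;> split_ifs <;> omega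
  | succ s =>
    have := s.isLt
    simp only [tokenShift, AddMonoidHom.coe_mk, ZeroHom.coe_mk, Fin.cons_succ, pyramidStep,
      Fin.ext_iff, Fin.val_succ]
    rcases key with ⟨h, key⟩ | ⟨h, key⟩ <;> split_ifs <;> omega

theorem sum_tokens (i : Fin n → ℤ) : ∑ t, tokens n m i t = (m : ℤ) - 1 := by
  simp [Fin.sum_univ_succ, tokens]

/-- Since every `i t - 1` is nonnegative, the bound on the full sum implies the bounds on all
partial sums. The full bound says that place `0` holds a nonnegative number of tokens. -/
theorem isPyramidVertex_iff (hn : 1 ≤ n) (i : Fin n → ℤ) :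
    IsPyramidVertex n m i ↔ ∀ t, 0 ≤ tokens n m i t := by
  constructor
  · rintro ⟨h1, h2⟩ t
    cases t using Fin.cases with
    | zero =>
      have h3 := h2 ⟨n - 1, by omega⟩
      have h4 : Finset.univ.filter (fun t : Fin n => t ≤ ⟨n - 1, by omega⟩) = Finset.univ := by
        ext t
        have := t.isLt
        simp [Fin.le_def]
        omega
      rw [h4] at h3
      simp [tokens, Finset.sum_sub_distrib]
      simp at h3
      omega
    | succ s =>
      have := h1 s
      simp [tokens]
      omega
  · intro h
    have h1 : ∀ s, 1 ≤ i s := fun s => by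
      have := h s.succ
      simp [tokens] at this
      omega
    refine ⟨h1, fun s => ?_⟩
    have h0 := h 0
    simp only [tokens, Fin.cons_zero] at h0
    have h2 : ∑ t ∈ Finset.univ.filter (fun t => t ≤ s), (i t - 1) ≤ ∑ t, (i t - 1) :=
      Finset.sum_le_sum_of_subset_of_nonneg (Finset.subset_univ _)
        fun t _ _ => by have := h1 t; omega
    have h3 : (Finset.univ.filter (fun t => t ≤ s)).card = (s : ℕ) + 1 := by
      have : Finset.univ.filter (fun t => t ≤ s) = Finset.Iic s := by ext; simp
      rw [this, Fin.card_Iic]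
    rw [Finset.sum_sub_distrib] at h2
    simp only [Finset.sum_const, h3, nsmul_eq_mul, mul_one] at h2
    push_cast at h2
    omega

/-- The vector `i + ∑_{s ∈ J} (e_s - e_{s-1})`. -/
def moveAll (i : Fin n → ℤ) (J : Finset (Fin (n + 1))) : Fin n → ℤ :=
  i + ∑ s ∈ J, pyramidStep n s

@[simp] theorem moveAll_empty (i : Fin n → ℤ) : moveAll i ∅ = i := by simp [moveAll]

theorem moveAll_insert (i : Fin n → ℤ) {J : Finset (Fin (n + 1))} {t : Fin (n + 1)} (h : t ∉ J) :
    moveAll i (insert t J) = moveAll i J + pyramidStep n t := by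
  rw [moveAll, moveAll, Finset.sum_insert h]
  abel

theorem moveAll_erase (i : Fin n → ℤ) {J : Finset (Fin (n + 1))} {t : Fin (n + 1)} (h : t ∈ J) :
    moveAll i (J.erase t) + pyramidStep n t = moveAll i J := by
  rw [← moveAll_insert i (Finset.notMem_erase t J), Finset.insert_erase h]

theorem moveAll_moveAll (i : Fin n → ℤ) {J K : Finset (Fin (n + 1))} (h : Disjoint J K) :
    moveAll (moveAll i J) K = moveAll i (J ∪ K) := by
  rw [moveAll, moveAll, moveAll, Finset.sum_union h, add_assoc]

theorem tokens_step (hn : 1 ≤ n) (i : Fin n → ℤ) (t u : Fin (n + 1)) :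
    tokens n m (i + pyramidStep n t) u
      = tokens n m i u + (if u = t + 1 then 1 else 0) - (if u = t then 1 else 0) := by
  rw [tokens_add, Pi.add_apply, tokenShift_step hn]
  ring

theorem tokens_sub_step (hn : 1 ≤ n) (i : Fin n → ℤ) (t u : Fin (n + 1)) :
    tokens n m (i - pyramidStep n t) u
      = tokens n m i u - (if u = t + 1 then 1 else 0) + (if u = t then 1 else 0) := by
  have := tokens_step (m := m) hn (i - pyramidStep n t) t u
  rw [sub_add_cancel] at this
  omega

theorem tokenShift_sum_smul (hn : 1 ≤ n) (z : Fin (n + 1) → ℤ) (u : Fin (n + 1)) :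
    tokenShift n (∑ s, z s • pyramidStep n s) u = z (u - 1) - z u := by
  rw [map_sum, Finset.sum_apply]
  simp only [map_zsmul, Pi.smul_apply, tokenShift_step hn, smul_eq_mul, mul_sub, mul_ite, mul_one,
    mul_zero, Finset.sum_sub_distrib, ← sub_eq_iff_eq_add]
  simp

theorem tokens_moveAll (hn : 1 ≤ n) (i : Fin n → ℤ) (J : Finset (Fin (n + 1))) (u : Fin (n + 1)) :
    tokens n m (moveAll i J) u
      = tokens n m i u + (if u - 1 ∈ J then 1 else 0) - (if u ∈ J then 1 else 0) := by
  have := tokenShift_sum_smul hn (fun s => if s ∈ J then 1 else 0) u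
  simp only [ite_smul, one_smul, zero_smul, Finset.sum_ite_mem, Finset.univ_inter] at this
  rw [moveAll, tokens_add, Pi.add_apply, this]
  ring

/-- Every place gains one token and loses one. This is the source of the trivial translation. -/
theorem moveAll_univ (hn : 1 ≤ n) (i : Fin n → ℤ) : moveAll i Finset.univ = i := by
  have : ∑ s, pyramidStep n s = 0 := by
    apply tokenShift_injective
    ext u
    have := tokenShift_sum_smul hn (fun _ => 1) u
    simpa using this
  rw [moveAll, this, add_zero]

/-- A nonempty set of places on a cycle that is closed under successors is everything. -/
theorem eq_univ_of_add_one_mem {J : Finset (Fin (n + 1))} (hJ : J.Nonempty)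
    (h : ∀ v ∈ J, v + 1 ∈ J) : J = Finset.univ := by
  obtain ⟨a, ha⟩ := hJ
  have key : ∀ r : ℕ, a + (Fin.ofNat (n + 1) r) ∈ J := by
    intro r
    induction r with
    | zero => simpa using ha
    | succ r ih =>
      have := h _ ih
      rwa [add_assoc, show Fin.ofNat (n + 1) r + 1 = Fin.ofNat (n + 1) (r + 1) from ?_] at this
      ext
      simp [Fin.val_add]
  ext b
  have := key (b - a).val
  simp only [Fin.ofNat_val_eq_self, add_sub_cancel] at this
  simp [this]

theorem exists_mem_add_one_notMem {J : Finset (Fin (n + 1))} (hJ : J.Nonempty)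
    (h : J ≠ Finset.univ) : ∃ v ∈ J, v + 1 ∉ J := by
  by_contra! H
  exact h (eq_univ_of_add_one_mem hJ H)

/-- Undoing moves of different types takes tokens from different places `s + 1` and `t + 1`, so the
two undoings do not compete. This is the diamond property used in both path-independence arguments.
-/
theorem isPyramidVertex_sub_sub (hn : 1 ≤ n) {i : Fin n → ℤ} {s t : Fin (n + 1)} (hst : s ≠ t)
    (h : IsPyramidVertex n m i) (hs : IsPyramidVertex n m (i - pyramidStep n s))
    (ht : IsPyramidVertex n m (i - pyramidStep n t)) :
    IsPyramidVertex n m (i - pyramidStep n s - pyramidStep n t) := by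
  rw [isPyramidVertex_iff hn] at *
  intro u
  have h1 := h u
  have h2 := hs u
  have h3 := ht u
  rw [tokens_sub_step hn] at h2 h3
  rw [tokens_sub_step hn, tokens_sub_step hn]
  have h4 : ¬ (u = s + 1 ∧ u = t + 1) := fun ⟨h5, h6⟩ => hst (add_right_cancel (h5.symm.trans h6))
  split_ifs at * <;> simp_all

theorem isPyramidVertex_step_iff (hn : 1 ≤ n) {i : Fin n → ℤ} (h : IsPyramidVertex n m i)
    (t : Fin (n + 1)) : IsPyramidVertex n m (i + pyramidStep n t) ↔ 1 ≤ tokens n m i t := by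
  have ht : t ≠ t + 1 := by
    intro h
    have : (1 : Fin (n + 1)) = 0 := by simpa using h.symm
    have := congrArg Fin.val this
    simp [Nat.mod_eq_of_lt (show 1 < n + 1 by omega)] at this
  rw [isPyramidVertex_iff hn] at *
  constructor
  · intro h'
    have := h' t
    rw [tokens_step hn, if_neg ht, if_pos rfl] at this
    omega
  · intro h1 u
    have h2 := h u
    rw [tokens_step hn]
    by_cases hu : u = t
    · subst hu; rw [if_pos rfl]; split_ifs <;> omega
    · rw [if_neg hu]; split_ifs <;> omega

theorem isPyramidVertex_sub_iff (hn : 1 ≤ n) {i : Fin n → ℤ} (h : IsPyramidVertex n m i)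
    (t : Fin (n + 1)) :
    IsPyramidVertex n m (i - pyramidStep n t) ↔ 1 ≤ tokens n m i (t + 1) := by
  have ht : t + 1 ≠ t := by
    intro h
    have : (1 : Fin (n + 1)) = 0 := by simpa using h
    have := congrArg Fin.val this
    simp [Nat.mod_eq_of_lt (show 1 < n + 1 by omega)] at this
  rw [isPyramidVertex_iff hn] at *
  constructor
  · intro h'
    have := h' (t + 1)
    rw [tokens_sub_step hn, if_neg ht, if_pos rfl] at this
    omega
  · intro h1 u
    have h2 := h u
    rw [tokens_sub_step hn]
    by_cases hu : u = t + 1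
    · subst hu; rw [if_pos rfl]; split_ifs <;> omega
    · rw [if_neg hu]; split_ifs <;> omega

/-- Some element of `J` can be moved last. -/
theorem exists_removable (hn : 1 ≤ n) (hm : 2 ≤ m) {i : Fin n → ℤ} {J : Finset (Fin (n + 1))}
    (hi : IsPyramidVertex n m i) (hJ : J.Nonempty) (h : IsPyramidVertex n m (moveAll i J)) :
    ∃ t ∈ J, IsPyramidVertex n m (moveAll i (J.erase t)) := by
  have key : ∃ t ∈ J, 1 ≤ tokens n m (moveAll i J) (t + 1) := by
    by_cases hu : J = Finset.univ
    · by_contra! H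
      have h1 := sum_tokens (m := m) (moveAll i J)
      have h2 : ∑ t, tokens n m (moveAll i J) t ≤ 0 := Finset.sum_nonpos fun t _ => by
        have := H (t - 1) (by simp [hu])
        rw [sub_add_cancel] at this
        omega
      omega
    · obtain ⟨v, hv, hv'⟩ := exists_mem_add_one_notMem hJ hu
      refine ⟨v, hv, ?_⟩
      rw [tokens_moveAll hn]
      have := (isPyramidVertex_iff hn i).1 hi (v + 1)
      simp [hv, hv']
      omega
  obtain ⟨t, ht, h1⟩ := key
  refine ⟨t, ht, ?_⟩
  rw [← isPyramidVertex_sub_iff hn h, ← moveAll_erase i ht, add_sub_cancel_right] at h1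
  exact h1

/-- Some element outside of `J` can be moved next. -/
theorem exists_addable (hn : 1 ≤ n) (hm : 2 ≤ m) {i : Fin n → ℤ} {J : Finset (Fin (n + 1))}
    (hi : IsPyramidVertex n m i) (hJ : J ≠ Finset.univ)
    (h : IsPyramidVertex n m (moveAll i J)) :
    ∃ t, t ∉ J ∧ IsPyramidVertex n m (moveAll i (insert t J)) := by
  have key : ∃ t, t ∉ J ∧ 1 ≤ tokens n m (moveAll i J) t := by
    rcases J.eq_empty_or_nonempty with rfl | hne
    · by_contra! H
      have h1 := sum_tokens (m := m) i
      have h2 : ∑ t, tokens n m i t ≤ 0 := Finset.sum_nonpos fun t _ => by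
        have := H t (by simp)
        rw [moveAll_empty] at this
        omega
      omega
    · obtain ⟨v, hv, hv'⟩ := exists_mem_add_one_notMem hne hJ
      refine ⟨v + 1, hv', ?_⟩
      rw [tokens_moveAll hn]
      have := (isPyramidVertex_iff hn i).1 hi (v + 1)
      simp [hv, hv']
      omega
  obtain ⟨t, ht, h1⟩ := key
  exact ⟨t, ht, by rwa [moveAll_insert i ht, isPyramidVertex_step_iff hn h]⟩

/-- If `J` contains `t` and `t` can be moved once more, then either `t` can be moved last in `J`, or
some other element can be, with `t` still movable before it. -/
theorem exists_removable_of_mem (hn : 1 ≤ n) (hm : 3 ≤ m) {i : Fin n → ℤ}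
    {J : Finset (Fin (n + 1))} {t : Fin (n + 1)} (hi : IsPyramidVertex n m i)
    (h : IsPyramidVertex n m (moveAll i J)) (ht : t ∈ J)
    (h' : IsPyramidVertex n m (moveAll i J + pyramidStep n t)) :
    ∃ s ∈ J, IsPyramidVertex n m (moveAll i (J.erase s)) ∧
      (s ≠ t → IsPyramidVertex n m (moveAll i (J.erase s) + pyramidStep n t)) := by
  have h1 := (isPyramidVertex_step_iff hn h t).1 h'
  have key : ∃ s ∈ J, 1 ≤ tokens n m (moveAll i J) (s + 1) ∧
      (s + 1 = t → 2 ≤ tokens n m (moveAll i J) t) := by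
    -- If `J` is everything, either place `t` has a token to spare and the move `t - 1` can be
    -- undone, or it has just one. In the latter case one of the at least two tokens lies elsewhere;
    -- this uses `3 ≤ m`.
    by_cases hu : J = Finset.univ
    · by_cases h2 : 2 ≤ tokens n m (moveAll i J) t
      · exact ⟨t - 1, by simp [hu], by simpa using h1, fun _ => h2⟩
      · by_contra! H
        have h3 := sum_tokens (m := m) (moveAll i J)
        have h4 : ∑ u, tokens n m (moveAll i J) u ≤ ∑ u, if u = t then 1 else 0 := by
          refine Finset.sum_le_sum fun u _ => ?_
          split_ifs with hut
          · subst hut; omega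
          · by_contra h5
            exact hut (by simpa using (H (u - 1) (by simp [hu]) (by simp; omega)).1)
        simp at h4
        omega
    · obtain ⟨v, hv, hv'⟩ := exists_mem_add_one_notMem ⟨t, ht⟩ hu
      refine ⟨v, hv, ?_, fun h => absurd ht (h ▸ hv')⟩
      rw [tokens_moveAll hn]
      have := (isPyramidVertex_iff hn i).1 hi (v + 1)
      simp [hv, hv']
      omega
  obtain ⟨s, hs, h2, h3⟩ := key
  have e : moveAll i (J.erase s) = moveAll i J - pyramidStep n s := by
    rw [← moveAll_erase i hs, add_sub_cancel_right]
  have hv : IsPyramidVertex n m (moveAll i (J.erase s)) := by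
    rwa [e, isPyramidVertex_sub_iff hn h]
  refine ⟨s, hs, hv, fun hst => ?_⟩
  rw [isPyramidVertex_step_iff hn hv, e, tokens_sub_step hn]
  by_cases h5 : t = s
  · exact absurd h5.symm hst
  rw [if_neg h5]
  split_ifs with h4
  · have := h3 h4.symm; omega
  · omega

/-- Two sets of the same cardinality with the same total displacement are equal. -/
theorem eq_of_moveAll_eq (hn : 1 ≤ n) {i : Fin n → ℤ} {J K : Finset (Fin (n + 1))}
    (h : moveAll i J = moveAll i K) (hc : J.card = K.card) : J = K := by
  -- Place `u` gains a token under `J` but not under `K`. As the final counts agree, it must also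
  -- lose one under `J` only.
  have key : ∀ u : Fin (n + 1), u - 1 ∈ J \ K → u ∈ J \ K := by
    intro u hu
    have h1 := tokens_moveAll (m := 0) hn i J u
    have h2 := tokens_moveAll (m := 0) hn i K u
    rw [h] at h1
    simp only [Finset.mem_sdiff] at hu ⊢
    simp only [hu.1, hu.2, if_true, if_false] at h1 h2
    split_ifs at h1 h2 with h3 h4 <;> first | omega | exact ⟨h3, h4⟩
  have hsub : J \ K = ∅ := by
    by_contra hne
    have h1 := eq_univ_of_add_one_mem (Finset.nonempty_iff_ne_empty.2 hne)
      (fun v hv => key (v + 1) (by simpa using hv))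
    have h2 : J = Finset.univ :=
      Finset.eq_univ_of_forall fun x => (Finset.mem_sdiff.1 (h1 ▸ Finset.mem_univ x)).1
    have h3 : K = Finset.univ := (Finset.card_eq_iff_eq_univ K).1 (by rw [← hc, h2]; rfl)
    rw [h2, h3, Finset.sdiff_self] at hne
    exact hne rfl
  exact Finset.eq_of_subset_of_card_le (Finset.sdiff_eq_empty_iff_subset.1 hsub) hc.ge

end Tokens

/-! ### Path-independent recursion and removal of the twist -/

/-- Recursion along the edges of a graded graph whose edges into a vertex satisfy the diamond
property. -/
theorem exists_potential {X M T : Type*} (ht : X → ℕ) (E : T → X → X → Prop)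
    (act : T → X → M → M) (base : X → M)
    (hE : ∀ t x y, E t x y → ht y = ht x + 1)
    (det : ∀ t x x' y, E t x y → E t x' y → x = x')
    (dia : ∀ s t x x' y, s ≠ t → E s x y → E t x' y →
      ∃ z, E t z x ∧ E s z x' ∧ ∀ v, act s x (act t z v) = act t x' (act s z v)) :
    ∃ H : X → M, (∀ t x y, E t x y → H y = act t x (H x)) ∧
      ∀ y, (∀ t x, ¬ E t x y) → H y = base y := by
  classical
  -- The value at `y` is computed along one arbitrarily chosen incoming edge. That every other
  -- incoming edge gives the same value is proved afterwards by induction on the height.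
  let F : ∀ y : X, (∀ x : X, ht x < ht y → M) → M := fun y rec =>
    if h : ∃ p : T × X, E p.1 p.2 y then
      act h.choose.1 h.choose.2
        (rec h.choose.2 (by rw [hE _ _ _ h.choose_spec]; exact Nat.lt_succ_self _))
    else base y
  let wf : WellFounded fun x y : X => ht x < ht y := InvImage.wf ht Nat.lt_wfRel.wf
  have hfix : ∀ y, wf.fix F y = F y (fun x _ => wf.fix F x) := fun y => wf.fix_eq F y
  refine ⟨wf.fix F, ?_, ?_⟩
  · suffices H : ∀ N t x y, ht y = N → E t x y → wf.fix F y = act t x (wf.fix F x) from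
      fun t x y h => H _ t x y rfl h
    intro N
    induction N with
    | zero =>
      intro t x y hy h
      have := hE _ _ _ h
      omega
    | succ N ih =>
      intro t x y hy h
      have hex : ∃ p : T × X, E p.1 p.2 y := ⟨(t, x), h⟩
      have h1 : wf.fix F y = act hex.choose.1 hex.choose.2 (wf.fix F hex.choose.2) := by
        rw [hfix]
        simp only [F]
        rw [dif_pos hex]
      rw [h1]
      have hs := hex.choose_spec
      generalize hex.choose = p at hs
      obtain ⟨s, x'⟩ := p
      change E s x' y at hs
      by_cases hst : s = t
      · subst hst
        rw [det _ _ _ _ hs h]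
      -- Both predecessors have smaller height, so their values are already known to come from the
      -- common predecessor `z`.
      · obtain ⟨z, hz1, hz2, hz⟩ := dia _ _ _ _ _ hst hs h
        have e1 := hE _ _ _ hs
        have e2 := hE _ _ _ h
        change act s x' (wf.fix F x') = _
        rw [ih _ _ _ (by omega) hz1, ih _ _ _ (by omega) hz2, hz]
  · intro y hy
    rw [hfix]
    simp only [F]
    rw [dif_neg]
    rintro ⟨p, hp⟩
    exact hy _ _ hp

section GaugeExistence

variable {k : Type u} [Field k] {n m : ℕ}

/-- Scalars `c t i` that turn the relation `d_{s,t,i} γ_t γ_s = γ_s γ_t` into a commutation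
relation. -/
def IsGauge (m : ℕ) (d : Fin (n + 1) → Fin (n + 1) → (Fin n → ℤ) → k)
    (c : Fin (n + 1) → (Fin n → ℤ) → kˣ) : Prop :=
  ∀ (s t : Fin (n + 1)) (i : Fin n → ℤ), t < s → IsPyramidVertex n m i →
    IsPyramidVertex n m (i + pyramidStep n s) → IsPyramidVertex n m (i + pyramidStep n t) →
    IsPyramidVertex n m (i + pyramidStep n s + pyramidStep n t) →
    d s t i * c t (i + pyramidStep n s) * c s i = c s (i + pyramidStep n t) * c t i

theorem IsPyramidVertex.cube {i : Fin n → ℤ} {r s t : Fin (n + 1)} (hst : t < s) (hrs : s < r)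
    (h : IsPyramidVertex n m i) (hr : IsPyramidVertex n m (i + pyramidStep n r))
    (hs : IsPyramidVertex n m (i + pyramidStep n s))
    (ht : IsPyramidVertex n m (i + pyramidStep n t))
    (hrs' : IsPyramidVertex n m (i + pyramidStep n r + pyramidStep n s))
    (hrt : IsPyramidVertex n m (i + pyramidStep n r + pyramidStep n t))
    (hst' : IsPyramidVertex n m (i + pyramidStep n s + pyramidStep n t))
    (hrst : IsPyramidVertex n m (i + pyramidStep n r + pyramidStep n s + pyramidStep n t))
    (J : Finset (Fin (n + 1))) (hJ : J ⊆ {r, s, t}) :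
    IsPyramidVertex n m (i + ∑ x ∈ J, pyramidStep n x) := by
  have e : ∑ x ∈ J, pyramidStep n x
      = ∑ x ∈ ({r, s, t} : Finset (Fin (n + 1))), if x ∈ J then pyramidStep n x else 0 := by
    rw [Finset.sum_ite_mem, Finset.inter_eq_right.2 hJ]
  rw [e, Finset.sum_insert (by simp [hrs.ne', (hst.trans hrs).ne']),
    Finset.sum_insert (by simp [hst.ne']), Finset.sum_singleton]
  split_ifs <;> simpa [← add_assoc]

/-- A unit of `k`, equal to `a` if `a ≠ 0`. -/
def unitOf (a : k) : kˣ :=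
  open scoped Classical in if h : a = 0 then 1 else Units.mk0 a h

theorem val_unitOf {a : k} (h : a ≠ 0) : (unitOf a : k) = a := by
  simp [unitOf, h]

/-- Once the types below `r` are rescaled, the relations between `r` and a smaller `t` prescribe the
ratio of `c r` at `x + pyramidStep n t` to `c r` at `x`. These ratios agree around every square by
compatibility of the twist, so they can be integrated to a function `c r`. -/
theorem exists_gauge_lt (hn : 1 ≤ n) {d : Fin (n + 1) → Fin (n + 1) → (Fin n → ℤ) → k}
    (hd : IsPyramidTwist n m d) (R : ℕ) (hR : R ≤ n + 1) :
    ∃ c : Fin (n + 1) → (Fin n → ℤ) → kˣ, ∀ (s t : Fin (n + 1)) (i : Fin n → ℤ), t < s →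
      (s : ℕ) < R → IsPyramidVertex n m i →
      IsPyramidVertex n m (i + pyramidStep n s) → IsPyramidVertex n m (i + pyramidStep n t) →
      IsPyramidVertex n m (i + pyramidStep n s + pyramidStep n t) →
      d s t i * c t (i + pyramidStep n s) * c s i = c s (i + pyramidStep n t) * c t i := by
  induction R with
  | zero => exact ⟨fun _ _ => 1, fun s t i _ h => absurd h (Nat.not_lt_zero _)⟩
  | succ R ih =>
    obtain ⟨c, hc⟩ := ih (by omega)
    let r : Fin (n + 1) := ⟨R, by omega⟩
    let reg : (Fin n → ℤ) → Prop := fun x =>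
      IsPyramidVertex n m x ∧ IsPyramidVertex n m (x + pyramidStep n r)
    -- The gauge equation for `r` and `t`, solved for the ratio of the two values of `c r`.
    let h : Fin (n + 1) → (Fin n → ℤ) → kˣ := fun t x =>
      unitOf (d r t x) * c t (x + pyramidStep n r) / c t x
    let E : Fin (n + 1) → (Fin n → ℤ) → (Fin n → ℤ) → Prop := fun t x y =>
      t < r ∧ y = x + pyramidStep n t ∧ reg x ∧ reg y
    have cocycle : ∀ s t x, t < s → s < r → reg x → reg (x + pyramidStep n s) →
        reg (x + pyramidStep n t) → reg (x + pyramidStep n s + pyramidStep n t) →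
        h t (x + pyramidStep n s) * h s x = h s (x + pyramidStep n t) * h t x := by
      intro s t x hts hsr h0 hs ht hst
      have c1 := hc s t x hts hsr h0.1 hs.1 ht.1 hst.1
      have e1 : x + pyramidStep n r + pyramidStep n s = x + pyramidStep n s + pyramidStep n r := by
        abel
      have e2 : x + pyramidStep n r + pyramidStep n t = x + pyramidStep n t + pyramidStep n r := by
        abel
      have e3 : x + pyramidStep n r + pyramidStep n s + pyramidStep n t
          = x + pyramidStep n s + pyramidStep n t + pyramidStep n r := by abel
      have e4 : x + pyramidStep n t + pyramidStep n s = x + pyramidStep n s + pyramidStep n t := by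
        abel
      have c2 := hc s t (x + pyramidStep n r) hts hsr h0.2 (e1 ▸ hs.2) (e2 ▸ ht.2) (e3 ▸ hst.2)
      have c3 := hd.compatible r s t x hts hsr
        (IsPyramidVertex.cube hts hsr h0.1 h0.2 hs.1 ht.1 (e1 ▸ hs.2) (e2 ▸ ht.2) hst.1
          (e3 ▸ hst.2))
      have n1 := hd.ne_zero s t x hts h0.1 hs.1 ht.1 hst.1
      have n3 := hd.ne_zero r t x (hts.trans hsr) h0.1 h0.2 ht.1 (e2 ▸ ht.2)
      have n4 := hd.ne_zero r s x hsr h0.1 h0.2 hs.1 (e1 ▸ hs.2)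
      have n5 := hd.ne_zero r s (x + pyramidStep n t) hsr ht.1 ht.2 (e4 ▸ hst.1)
        (by rw [add_right_comm, e4]; exact hst.2)
      have n6 := hd.ne_zero r t (x + pyramidStep n s) (hts.trans hsr) hs.1 hs.2 hst.1
        (by rw [add_right_comm]; exact hst.2)
      rw [e1, e2] at c2
      apply Units.ext
      simp only [h, Units.val_mul, Units.val_div_eq_div_val, val_unitOf n3, val_unitOf n4,
        val_unitOf n5, val_unitOf n6]
      have u1 := (c t x).ne_zero
      have u2 := (c s x).ne_zero
      have u3 := (c t (x + pyramidStep n s)).ne_zero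
      have u4 := (c s (x + pyramidStep n t)).ne_zero
      rw [div_mul_div_comm, div_mul_div_comm, div_eq_div_iff (mul_ne_zero u3 u2)
        (mul_ne_zero u4 u1), ← c1]
      linear_combination (c t (x + pyramidStep n s) * c s x : k) *
        ((c t (x + pyramidStep n s + pyramidStep n r) * c s (x + pyramidStep n r) : k) * c3 +
        (d r s (x + pyramidStep n t) * d r t x) * c2)
    -- The height is the weighted sum `∑ (s + 1) x_s`. It rises by one under each type `t < n`, and
    -- only types below `r ≤ n` occur, so the cyclic type never interferes.
    obtain ⟨H, hH, -⟩ := exists_potential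
      (fun x : Fin n → ℤ => (∑ s : Fin n, ((s : ℤ) + 1) * (x s)).toNat) E
      (fun t x v => h t x * v) (fun _ => 1) (by
        rintro t x y ⟨htr, rfl, hx, hy⟩
        have ht : (t : ℕ) < n := lt_of_lt_of_le (Fin.lt_def.1 htr) (by simp only [r]; omega)
        have h1 : ∑ s : Fin n, ((s : ℤ) + 1) * pyramidStep n t s = 1 := by
          have h2 : ∑ s : Fin n, ((s : ℤ) + 1) * (if (s : ℕ) = t then 1 else 0) = t + 1 := by
            rw [Finset.sum_eq_single ⟨t, ht⟩]
            · simp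
            · intro b _ hb
              rw [if_neg fun h' => hb (Fin.ext h'), mul_zero]
            · simp
          have h3 : ∑ s : Fin n, ((s : ℤ) + 1) * (if (s : ℕ) + 1 = t then 1 else 0) = t := by
            by_cases h0 : (t : ℕ) = 0
            · rw [h0]
              simp
            · rw [Finset.sum_eq_single ⟨t - 1, by omega⟩]
              · rw [if_pos (by simp; omega)]
                simp
                omega
              · intro b _ hb
                rw [if_neg fun h' => hb (Fin.ext (by simp; omega)), mul_zero]
              · simp
          simp only [pyramidStep, mul_sub, Finset.sum_sub_distrib, h2, h3]
          ring
        have h2 : 0 ≤ ∑ s : Fin n, ((s : ℤ) + 1) * (x s) :=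
          Finset.sum_nonneg fun s _ => mul_nonneg (by positivity) (by linarith [hx.1.1 s])
        simp only [Pi.add_apply, mul_add, Finset.sum_add_distrib] at h1 ⊢
        omega) (by
        rintro t x x' y ⟨-, rfl, -, -⟩ ⟨-, h, -, -⟩
        exact add_right_cancel h) (by
        rintro s t x x' y hst ⟨hs, rfl, hx, hy⟩ ⟨ht, e, hx', -⟩
        have e' : x' = x + pyramidStep n s - pyramidStep n t := by rw [e, add_sub_cancel_right]
        subst e'
        have es : x + pyramidStep n s - pyramidStep n s = x := add_sub_cancel_right _ _
        have hz : reg (x - pyramidStep n t) := by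
          constructor
          · have := isPyramidVertex_sub_sub hn hst hy.1 (by rw [es]; exact hx.1) hx'.1
            rwa [es] at this
          · have := isPyramidVertex_sub_sub hn hst hy.2
              (by rw [add_right_comm, add_sub_cancel_right]; exact hx.2)
              (by rw [add_sub_right_comm]; exact hx'.2)
            rwa [show x + pyramidStep n s + pyramidStep n r - pyramidStep n s - pyramidStep n t
              = x - pyramidStep n t + pyramidStep n r by abel] at this
        have e1 : x - pyramidStep n t + pyramidStep n s = x + pyramidStep n s - pyramidStep n t := by
          abel
        refine ⟨x - pyramidStep n t, ⟨ht, by abel, hz, hx⟩, ⟨hs, by abel, hz, hx'⟩, fun v => ?_⟩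
        simp only [← mul_assoc]
        congr 1
        rcases lt_or_gt_of_ne hst with hlt | hlt
        · have := cocycle t s (x - pyramidStep n t) hlt ht hz (by rwa [sub_add_cancel])
            (by rwa [e1]) (by rwa [sub_add_cancel])
          rwa [sub_add_cancel, e1] at this
        · have := cocycle s t (x - pyramidStep n t) hlt hs hz (by rwa [e1])
            (by rwa [sub_add_cancel]) (by rwa [e1, sub_add_cancel])
          rw [sub_add_cancel, e1] at this
          exact this.symm)
    refine ⟨Function.update c r H, fun s t i hts hsR h0 hs ht hst => ?_⟩
    by_cases hsr : s = r
    · subst hsr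
      rw [Function.update_self, Function.update_of_ne hts.ne]
      have := hH t i (i + pyramidStep n t) ⟨hts, rfl, ⟨h0, hs⟩, ht, by rwa [add_right_comm]⟩
      rw [this]
      simp only [h, Units.val_mul, Units.val_div_eq_div_val,
        val_unitOf (hd.ne_zero r t i hts h0 hs ht hst)]
      have u1 := (c t i).ne_zero
      field_simp
    · have hsr' : s < r := by
        refine lt_of_le_of_ne (Fin.le_def.2 ?_) hsr
        simp only [r]
        omega
      rw [Function.update_of_ne hsr, Function.update_of_ne (hts.trans hsr').ne]
      exact hc s t i hts hsr' h0 hs ht hst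

theorem exists_gauge (hn : 1 ≤ n) {d : Fin (n + 1) → Fin (n + 1) → (Fin n → ℤ) → k}
    (hd : IsPyramidTwist n m d) : ∃ c, IsGauge m d c := by
  obtain ⟨c, hc⟩ := exists_gauge_lt hn hd (n + 1) le_rfl
  exact ⟨c, fun s t i hts => hc s t i hts s.isLt⟩

end GaugeExistence

/-! ### Bound quiver algebras and the rescaled arrows -/

section BoundAlgebraGeneral

variable {k : Type u} {V : Type v} [Quiver.{w} V] [Field k] [Fintype V]

theorem toBound_eq_zero {ρ : Set (PathAlgebra k V)} {x : PathAlgebra k V} (hx : x ∈ ρ) :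
    toBound ρ x = 0 := by
  have := RingQuot.mkAlgHom_rel k (s := fun a b : PathAlgebra k V => a ∈ ρ ∧ b = 0)
    (x := x) (y := 0) ⟨hx, rfl⟩
  rw [map_zero] at this
  exact this

theorem toBound_surjective (ρ : Set (PathAlgebra k V)) : Function.Surjective (toBound ρ) :=
  RingQuot.mkAlgHom_surjective k _

theorem toBound_comp (ρ : Set (PathAlgebra k V)) {i j l : V} (p : Quiver.Path i j)
    (q : Quiver.Path j l) :
    toBound ρ (PathAlgebra.ofPath k (p.comp q))
      = toBound ρ (PathAlgebra.ofPath k q) * toBound ρ (PathAlgebra.ofPath k p) := by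
  rw [← PathAlgebra.ofPath_mul_ofPath, map_mul]

theorem toBound_cons (ρ : Set (PathAlgebra k V)) {i j l : V} (p : Quiver.Path i j) (a : j ⟶ l) :
    toBound ρ (PathAlgebra.ofPath k (p.cons a))
      = toBound ρ (PathAlgebra.ofPath k a.toPath) * toBound ρ (PathAlgebra.ofPath k p) :=
  toBound_comp ρ p a.toPath

theorem boundIdem_mul (ρ : Set (PathAlgebra k V)) {i j : V} (p : Quiver.Path i j) :
    boundIdem ρ j * toBound ρ (PathAlgebra.ofPath k p) = toBound ρ (PathAlgebra.ofPath k p) := by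
  rw [boundIdem, PathAlgebra.idem, ← toBound_comp, Quiver.Path.comp_nil]

theorem boundIdem_mul_of_ne (ρ : Set (PathAlgebra k V)) {i j l : V} (p : Quiver.Path i j)
    (h : l ≠ j) : boundIdem ρ l * toBound ρ (PathAlgebra.ofPath k p) = 0 := by
  rw [boundIdem, PathAlgebra.idem, ← map_mul, PathAlgebra.ofPath_mul_ofPath_of_ne _ _ h.symm,
    map_zero]

end BoundAlgebraGeneral

section Generators

variable {k : Type u} [Field k] {n m : ℕ}

/-- The algebra of the stable pyramid quiver. -/
abbrev PyramidAlgebra (m : ℕ) (d : Fin (n + 1) → Fin (n + 1) → (Fin n → ℤ) → k) : Type u :=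
  BoundAlgebra (stableRelations (m := m) d)

/-- A vector that satisfies the vertex condition, as a vertex. -/
def PyramidVertex.mk (i : Fin n → ℤ) (h : IsPyramidVertex n m i) : PyramidVertex n m := ⟨i, h⟩

/-- The arrow of type `t` that starts at `i`. -/
def pyramidArrow (t : Fin (n + 1)) (i : Fin n → ℤ) (h : IsPyramidVertex n m i)
    (h' : IsPyramidVertex n m (i + pyramidStep n t)) :
    PyramidVertex.mk i h ⟶ PyramidVertex.mk (i + pyramidStep n t) h' :=
  ⟨t, rfl⟩

variable (d : Fin (n + 1) → Fin (n + 1) → (Fin n → ℤ) → k)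
  (c : Fin (n + 1) → (Fin n → ℤ) → kˣ)

open scoped Classical in
/-- The rescaled arrow of type `t` at `i`, as an element of the algebra, or `0` if there is no such
arrow. -/
def gen (m : ℕ) (t : Fin (n + 1)) (i : Fin n → ℤ) : PyramidAlgebra m d :=
  if h : IsPyramidVertex n m i ∧ IsPyramidVertex n m (i + pyramidStep n t) then
    ((c t i)⁻¹ : kˣ).val • toBound (stableRelations (m := m) d)
      (PathAlgebra.ofPath k (pyramidArrow t i h.1 h.2).toPath)
  else 0

theorem gen_of_not {t : Fin (n + 1)} {i : Fin n → ℤ}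
    (h : ¬ (IsPyramidVertex n m i ∧ IsPyramidVertex n m (i + pyramidStep n t))) :
    gen d c m t i = 0 := dif_neg h

theorem toBound_arrow {i j : PyramidVertex n m} (a : i ⟶ j) :
    toBound (stableRelations (m := m) d) (PathAlgebra.ofPath k a.toPath)
      = (c (arrowType a) i.1).val • gen d c m (arrowType a) i.1 := by
  obtain ⟨i, hi⟩ := i
  obtain ⟨j, hj⟩ := j
  obtain ⟨t, ht⟩ := a
  change j = i + pyramidStep n t at ht
  subst ht
  change _ = (c t i).val • gen d c m t i
  rw [gen, dif_pos ⟨hi, hj⟩, smul_smul, Units.mul_inv, one_smul]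
  rfl

theorem boundIdem_mul_gen (j : PyramidVertex n m) (t : Fin (n + 1)) (i : Fin n → ℤ)
    (h : j.1 = i + pyramidStep n t) :
    boundIdem (stableRelations d) j * gen d c m t i = gen d c m t i := by
  unfold gen
  split_ifs with h'
  · rw [mul_smul_comm]
    congr 1
    obtain ⟨j, hj⟩ := j
    change j = _ at h
    subst h
    exact boundIdem_mul _ _
  · rw [mul_zero]

theorem gen_mul_boundIdem_of_ne (j : PyramidVertex n m) (t : Fin (n + 1)) (i : Fin n → ℤ)
    (h : j.1 ≠ i) : gen d c m t i * boundIdem (stableRelations d) j = 0 := by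
  unfold gen
  split_ifs with h'
  · have hne : j ≠ PyramidVertex.mk i h'.1 := fun h1 => h (h1 ▸ rfl)
    rw [smul_mul_assoc, boundIdem, PathAlgebra.idem, ← map_mul,
      PathAlgebra.ofPath_mul_ofPath_of_ne _ _ hne, map_zero, smul_zero]
  · rw [zero_mul]

variable {d c}

/-- The gauge equation makes the coefficients on both sides of the twisted relation the same unit,
which cancels. -/
theorem gen_mul_gen_of_lt (hc : IsGauge m d c) {s t : Fin (n + 1)} {i : Fin n → ℤ} (hts : t < s)
    (h : IsPyramidVertex n m i)
    (hs : IsPyramidVertex n m (i + pyramidStep n s))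
    (ht : IsPyramidVertex n m (i + pyramidStep n t))
    (hst : IsPyramidVertex n m (i + pyramidStep n s + pyramidStep n t)) :
    gen d c m t (i + pyramidStep n s) * gen d c m s i
      = gen d c m s (i + pyramidStep n t) * gen d c m t i := by
  let vi : PyramidVertex n m := ⟨i, h⟩
  let vj : PyramidVertex n m := ⟨i + pyramidStep n s, hs⟩
  let vj' : PyramidVertex n m := ⟨i + pyramidStep n t, ht⟩
  let vl : PyramidVertex n m := ⟨i + pyramidStep n s + pyramidStep n t, hst⟩
  let a : vi ⟶ vj := ⟨s, rfl⟩
  let b : vj ⟶ vl := ⟨t, rfl⟩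
  let a' : vi ⟶ vj' := ⟨t, rfl⟩
  let b' : vj' ⟶ vl := ⟨s, add_right_comm _ _ _⟩
  have h0 := toBound_eq_zero (ρ := stableRelations d)
    (Or.inl ⟨vi, vj, vj', vl, a, b, a', b', rfl, rfl, hts, rfl⟩)
  rw [map_sub, map_smul, sub_eq_zero, toBound_comp, toBound_comp, toBound_arrow d c a,
    toBound_arrow d c b, toBound_arrow d c a', toBound_arrow d c b'] at h0
  change d s t i • ((c t (i + pyramidStep n s)).val • gen d c m t (i + pyramidStep n s) *
    (c s i).val • gen d c m s i) = (c s (i + pyramidStep n t)).val •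
      gen d c m s (i + pyramidStep n t) * (c t i).val • gen d c m t i at h0
  simp only [smul_mul_smul_comm, smul_smul, ← mul_assoc] at h0
  rw [hc s t i hts h hs ht hst, ← Units.val_mul] at h0
  exact (smul_right_injective _ (Units.ne_zero _)) h0

theorem gen_mul_gen (hc : IsGauge m d c) {s t : Fin (n + 1)} {i : Fin n → ℤ} (hts : s ≠ t)
    (h : IsPyramidVertex n m i)
    (hs : IsPyramidVertex n m (i + pyramidStep n s))
    (ht : IsPyramidVertex n m (i + pyramidStep n t))
    (hst : IsPyramidVertex n m (i + pyramidStep n s + pyramidStep n t)) :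
    gen d c m t (i + pyramidStep n s) * gen d c m s i
      = gen d c m s (i + pyramidStep n t) * gen d c m t i := by
  rcases lt_or_gt_of_ne hts with hlt | hlt
  · exact (gen_mul_gen_of_lt hc hlt h ht hs (by rwa [add_right_comm])).symm
  · exact gen_mul_gen_of_lt hc hlt h hs ht hst

theorem gen_mul_gen_self (t : Fin (n + 1)) (i : Fin n → ℤ) :
    gen d c m t (i + pyramidStep n t) * gen d c m t i = 0 := by
  by_cases h : IsPyramidVertex n m i ∧ IsPyramidVertex n m (i + pyramidStep n t)
  · by_cases h' : IsPyramidVertex n m (i + pyramidStep n t + pyramidStep n t)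
    · rw [gen, gen, dif_pos h, dif_pos ⟨h.2, h'⟩, smul_mul_smul_comm, ← toBound_comp,
        toBound_eq_zero, smul_zero]
      exact Or.inr ⟨_, _, _, pyramidArrow t i h.1 h.2, pyramidArrow t _ h.2 h', rfl, rfl⟩
    · rw [gen_of_not d c fun h1 => h' h1.2, zero_mul]
  · rw [gen_of_not d c h, mul_zero]

/-- Every path is a trivial path multiplied on the left by arrows, and each arrow is a scalar
multiple of its rescaled version. Linearity over the algebra therefore needs checking only on
idempotents and rescaled arrows. -/
theorem pyramidAlgebra_induction (d : Fin (n + 1) → Fin (n + 1) → (Fin n → ℤ) → k)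
    (c : Fin (n + 1) → (Fin n → ℤ) → kˣ) {P : PyramidAlgebra m d → Prop} (h0 : P 0)
    (hadd : ∀ x y, P x → P y → P (x + y)) (hsmul : ∀ (a : k) x, P x → P (a • x))
    (hidem : ∀ j, P (boundIdem _ j)) (hgen : ∀ t i x, P x → P (gen d c m t i * x))
    (x : PyramidAlgebra m d) : P x := by
  obtain ⟨x, rfl⟩ := toBound_surjective _ x
  induction x using PathAlgebra.induction with
  | h0 => rwa [map_zero]
  | ha x y hx hy => rw [map_add]; exact hadd _ _ hx hy
  | hs a x hx => rw [map_smul]; exact hsmul _ _ hx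
  | @hp i j p =>
    induction p with
    | nil => exact hidem _
    | cons p a ih =>
      rw [toBound_cons, toBound_arrow d c, smul_mul_assoc]
      exact hsmul _ _ (hgen _ _ _ ih)

end Generators

/-! ### Products of rescaled arrows, indexed by sets of types -/

/-- A gauge for the twist, together with elements `b i J` of the algebra, each the product of the
rescaled arrows with types in `J` along any path that starts at `i`. -/
structure PyramidFrame {k : Type u} [Field k] {n m : ℕ}
    (d : Fin (n + 1) → Fin (n + 1) → (Fin n → ℤ) → k) where
  hn : 1 ≤ n
  hm : 3 ≤ m
  c : Fin (n + 1) → (Fin n → ℤ) → kˣ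
  gauge : IsGauge m d c
  b : PyramidVertex n m → Finset (Fin (n + 1)) → PyramidAlgebra m d
  b_empty : ∀ i, b i ∅ = boundIdem _ i
  gen_mul_b : ∀ i J t, t ∉ J → IsPyramidVertex n m (moveAll i.1 J) →
    IsPyramidVertex n m (moveAll i.1 (insert t J)) →
    gen d c m t (moveAll i.1 J) * b i J = b i (insert t J)

section Frame

variable {k : Type u} [Field k] {n m : ℕ}

/-- The sets `J` form a graph graded by cardinality whose edges add one legal type. Its diamonds are
the commuting squares of rescaled arrows, so `exists_potential` makes the product independent of the
order. -/
theorem nonempty_pyramidFrame (hn : 1 ≤ n) (hm : 3 ≤ m)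
    {d : Fin (n + 1) → Fin (n + 1) → (Fin n → ℤ) → k} (hd : IsPyramidTwist n m d) :
    Nonempty (PyramidFrame (m := m) d) := by
  obtain ⟨c, hc⟩ := exists_gauge hn hd
  have key : ∀ i : PyramidVertex n m, ∃ b : Finset (Fin (n + 1)) → PyramidAlgebra m d,
      b ∅ = boundIdem _ i ∧ ∀ J t, t ∉ J → IsPyramidVertex n m (moveAll i.1 J) →
        IsPyramidVertex n m (moveAll i.1 (insert t J)) →
        gen d c m t (moveAll i.1 J) * b J = b (insert t J) := by
    intro i
    -- The default value `e_i` matters only at `∅`. A set with an illegal endpoint also receives it,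
    -- but nothing is asserted there.
    obtain ⟨b, h1, h2⟩ := exists_potential (M := PyramidAlgebra m d)
      (fun J : Finset (Fin (n + 1)) => J.card)
      (fun t J K => t ∉ J ∧ K = insert t J ∧ IsPyramidVertex n m (moveAll i.1 J) ∧
        IsPyramidVertex n m (moveAll i.1 K))
      (fun t J v => gen d c m t (moveAll i.1 J) * v) (fun _ => boundIdem _ i)
      (by
        rintro t J _ ⟨ht, rfl, -, -⟩
        exact Finset.card_insert_of_notMem ht)
      (by
        rintro t J J' K ⟨ht, rfl, -, -⟩ ⟨ht', h, -, -⟩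
        rw [← Finset.erase_insert ht, h, Finset.erase_insert ht'])
      (by
        rintro s t J J' K hst ⟨hs, rfl, hJ, hK⟩ ⟨ht, h, hJ', -⟩
        have htJ : t ∈ J := by
          have : t ∈ insert s J := h ▸ Finset.mem_insert_self t J'
          exact (Finset.mem_insert.1 this).resolve_left hst.symm
        obtain ⟨L, htL, rfl⟩ : ∃ L, t ∉ L ∧ J = insert t L :=
          ⟨J.erase t, Finset.notMem_erase _ _, (Finset.insert_erase htJ).symm⟩
        have hsL : s ∉ L := fun h' => hs (Finset.mem_insert_of_mem h')
        have hJ'e : J' = insert s L := by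
          rw [← Finset.erase_insert ht, ← h, Finset.insert_comm, Finset.erase_insert]
          exact fun h' => (Finset.mem_insert.1 h').elim hst.symm htL
        subst hJ'e
        rw [moveAll_insert _ hs, moveAll_insert _ htL] at hK
        rw [moveAll_insert _ htL] at hJ
        rw [moveAll_insert _ hsL] at hJ'
        have hL : IsPyramidVertex n m (moveAll i.1 L) := by
          have := isPyramidVertex_sub_sub hn hst hK (by rwa [add_sub_cancel_right])
            (by rwa [add_right_comm, add_sub_cancel_right])
          rwa [add_sub_cancel_right, add_sub_cancel_right] at this
        refine ⟨L, ⟨htL, rfl, hL, ?_⟩, ⟨hsL, rfl, hL, ?_⟩, fun v => ?_⟩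
        · rwa [moveAll_insert _ htL]
        · rwa [moveAll_insert _ hsL]
        · simp only [← mul_assoc]
          rw [moveAll_insert _ htL, moveAll_insert _ hsL,
            gen_mul_gen hc hst.symm hL hJ hJ' hK])
    refine ⟨b, h2 ∅ ?_, fun J t ht hJ hK => (h1 t J _ ⟨ht, rfl, hJ, hK⟩).symm⟩
    rintro t J ⟨-, h, -, -⟩
    exact (Finset.insert_ne_empty t J) h.symm
  choose b hb1 hb2 using key
  exact ⟨⟨hn, hm, c, hc, b, hb1, hb2⟩⟩

namespace PyramidFrame

variable {d : Fin (n + 1) → Fin (n + 1) → (Fin n → ℤ) → k} (F : PyramidFrame (m := m) d)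

/-- The rescaled arrow of type `t` at `i`. -/
abbrev g (t : Fin (n + 1)) (i : Fin n → ℤ) : PyramidAlgebra m d := gen d F.c m t i

include F in
/-- Induction on the sets of types that lead from a vertex to a vertex. -/
theorem set_induction {i : PyramidVertex n m} {P : Finset (Fin (n + 1)) → Prop} (h0 : P ∅)
    (h1 : ∀ J t, t ∉ J → IsPyramidVertex n m (moveAll i.1 J) →
      IsPyramidVertex n m (moveAll i.1 (insert t J)) → P J → P (insert t J))
    (J : Finset (Fin (n + 1))) (hJ : IsPyramidVertex n m (moveAll i.1 J)) : P J := by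
  induction hN : J.card generalizing J with
  | zero =>
    rw [Finset.card_eq_zero] at hN
    rwa [hN]
  | succ N ih =>
    obtain ⟨t, ht, h⟩ := exists_removable F.hn (le_trans (by norm_num) F.hm) i.2
      (Finset.card_pos.1 (by omega)) hJ
    have := h1 (J.erase t) t (Finset.notMem_erase _ _) h (by rwa [Finset.insert_erase ht])
      (ih _ h (by rw [Finset.card_erase_of_mem ht, hN]; rfl))
    rwa [Finset.insert_erase ht] at this

theorem boundIdem_mul_b (i j : PyramidVertex n m) (J : Finset (Fin (n + 1)))
    (hJ : IsPyramidVertex n m (moveAll i.1 J)) (h : j.1 = moveAll i.1 J) :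
    boundIdem _ j * F.b i J = F.b i J := by
  revert h
  refine F.set_induction (P := fun J => j.1 = moveAll i.1 J → boundIdem _ j * F.b i J = F.b i J)
    ?_ ?_ J hJ
  · intro h
    rw [moveAll_empty] at h
    rw [Subtype.ext h, F.b_empty]
    exact boundIdem_mul _ _
  · intro J t ht h1 h2 _ h
    rw [moveAll_insert _ ht] at h
    rw [← F.gen_mul_b i J t ht h1 h2, ← mul_assoc, boundIdem_mul_gen _ _ _ _ _ h]

theorem boundIdem_mul_b_of_ne (i j : PyramidVertex n m) (J : Finset (Fin (n + 1)))
    (hJ : IsPyramidVertex n m (moveAll i.1 J)) (h : j.1 ≠ moveAll i.1 J) :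
    boundIdem _ j * F.b i J = 0 := by
  have hne : j ≠ PyramidVertex.mk _ hJ := fun h1 => h (h1 ▸ rfl)
  have e : boundIdem (stableRelations d) j * boundIdem (stableRelations d) (.mk _ hJ) = 0 :=
    boundIdem_mul_of_ne _ (Quiver.Path.nil : Quiver.Path (PyramidVertex.mk _ hJ) _) hne
  rw [← F.boundIdem_mul_b i (.mk _ hJ) J hJ rfl, ← mul_assoc, e, zero_mul]

theorem gen_mul_b_of_ne (i : PyramidVertex n m) (J : Finset (Fin (n + 1))) (t : Fin (n + 1))
    (l : Fin n → ℤ) (hJ : IsPyramidVertex n m (moveAll i.1 J)) (h : l ≠ moveAll i.1 J) :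
    F.g t l * F.b i J = 0 := by
  rw [← F.boundIdem_mul_b i (.mk _ hJ) J hJ rfl, ← mul_assoc,
    gen_mul_boundIdem_of_ne _ _ _ _ _ h.symm, zero_mul]

/-- The second arrow of type `t` is commuted backwards until it meets the first one, where the
square is zero. `exists_removable_of_mem` picks a last factor for which the commutation square
consists of vertices. -/
theorem gen_mul_b_of_mem (i : PyramidVertex n m) (J : Finset (Fin (n + 1))) (t : Fin (n + 1))
    (ht : t ∈ J) (hJ : IsPyramidVertex n m (moveAll i.1 J)) :
    F.g t (moveAll i.1 J) * F.b i J = 0 := by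
  by_cases h' : IsPyramidVertex n m (moveAll i.1 J + pyramidStep n t)
  swap
  · rw [g, gen_of_not _ _ fun h => h' h.2, zero_mul]
  induction hN : J.card generalizing J with
  | zero =>
    rw [Finset.card_eq_zero] at hN
    simp [hN] at ht
  | succ N ih =>
    obtain ⟨s, hs, h1, h2⟩ := exists_removable_of_mem F.hn F.hm i.2 hJ ht h'
    have e := moveAll_erase i.1 hs
    have e' := F.gen_mul_b i _ s (Finset.notMem_erase s J) h1 (by rwa [Finset.insert_erase hs])
    rw [Finset.insert_erase hs] at e'
    rw [← e', ← mul_assoc, ← e]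
    by_cases hst : s = t
    · subst hst
      rw [gen_mul_gen_self, zero_mul]
    · rw [← e] at hJ h'
      rw [gen_mul_gen F.gauge hst h1 hJ (h2 hst) h', mul_assoc,
        ih _ (Finset.mem_erase.2 ⟨Ne.symm hst, ht⟩) h1 (h2 hst)
          (by rw [Finset.card_erase_of_mem hs, hN]; rfl), mul_zero]

theorem b_mul_b (i j : PyramidVertex n m) (J K : Finset (Fin (n + 1))) (h : Disjoint J K)
    (hJ : j.1 = moveAll i.1 J) (hK : IsPyramidVertex n m (moveAll j.1 K)) :
    F.b j K * F.b i J = F.b i (J ∪ K) := by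
  revert h
  refine F.set_induction (P := fun K => Disjoint J K → F.b j K * F.b i J = F.b i (J ∪ K))
    ?_ ?_ K hK
  · intro _
    rw [F.b_empty, Finset.union_empty, F.boundIdem_mul_b i j J (hJ ▸ j.2) hJ]
  · intro K t ht h1 h2 ih h
    rw [Finset.disjoint_insert_right] at h
    have e1 : moveAll j.1 K = moveAll i.1 (J ∪ K) := by rw [hJ, moveAll_moveAll _ h.2]
    have htJK : t ∉ J ∪ K := by simp [h.1, ht]
    rw [← F.gen_mul_b j K t ht h1 h2, mul_assoc, ih h.2, e1, F.gen_mul_b i (J ∪ K) t htJK,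
      ← Finset.union_insert]
    · rwa [← e1]
    · rwa [moveAll_insert _ htJK, ← e1, ← moveAll_insert _ ht]

end PyramidFrame

end Frame

/-! ### Cube modules: an explicit model of sums of the projectives `Λ e_j` -/

section CubeModules

variable {k : Type u} [Field k] {n m : ℕ}
  {d : Fin (n + 1) → Fin (n + 1) → (Fin n → ℤ) → k}

/-- The functions on the pairs `(a, J)` for which moving the types in `J` leads from `base a` to a
vertex. -/
def CubeModule (_F : PyramidFrame (m := m) d) {A : Type} (base : A → PyramidVertex n m) : Type u :=
  {p : A × Finset (Fin (n + 1)) // IsPyramidVertex n m (moveAll (base p.1).1 p.2)} → k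

namespace CubeModule

variable {F : PyramidFrame (m := m) d} {A : Type} {base : A → PyramidVertex n m}

instance : AddCommGroup (CubeModule F base) :=
  inferInstanceAs (AddCommGroup
    ({p : A × Finset (Fin (n + 1)) // IsPyramidVertex n m (moveAll (base p.1).1 p.2)} → k))

instance : Module k (CubeModule F base) :=
  inferInstanceAs (Module k
    ({p : A × Finset (Fin (n + 1)) // IsPyramidVertex n m (moveAll (base p.1).1 p.2)} → k))

open scoped Classical in
/-- The coordinate at `(a, J)`, extended by zero. -/
def coord (a : A) (J : Finset (Fin (n + 1))) : CubeModule F base →ₗ[k] k where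
  toFun x := if h : IsPyramidVertex n m (moveAll (base a).1 J) then x ⟨(a, J), h⟩ else 0
  map_add' x y := by
    split_ifs
    · rfl
    · simp
  map_smul' r x := by
    split_ifs
    · rfl
    · simp

theorem coord_of_not {a : A} {J : Finset (Fin (n + 1))}
    (h : ¬ IsPyramidVertex n m (moveAll (base a).1 J)) (x : CubeModule F base) :
    coord a J x = 0 := dif_neg h

theorem ext {x y : CubeModule F base}
    (h : ∀ a J, IsPyramidVertex n m (moveAll (base a).1 J) → coord a J x = coord a J y) :
    x = y := by
  funext ⟨⟨a, J⟩, hJ⟩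
  have := h a J hJ
  simpa only [coord, LinearMap.coe_mk, AddHom.coe_mk, dif_pos hJ] using this

/-- The element with given coordinates. -/
def ofFun (F : PyramidFrame (m := m) d) (base : A → PyramidVertex n m)
    (f : A → Finset (Fin (n + 1)) → k) : CubeModule F base := fun p => f p.1.1 p.1.2

theorem coord_ofFun {f : A → Finset (Fin (n + 1)) → k} {a : A} {J : Finset (Fin (n + 1))}
    (h : IsPyramidVertex n m (moveAll (base a).1 J)) : coord a J (ofFun F base f) = f a J :=
  dif_pos h

open scoped Classical in
/-- The action of the trivial path at `j`. -/
def actIdem (F : PyramidFrame (m := m) d) (base : A → PyramidVertex n m) (j : PyramidVertex n m) :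
    Module.End k (CubeModule F base) where
  toFun x := ofFun F base fun a J => if moveAll (base a).1 J = j.1 then coord a J x else 0
  map_add' x y := ext fun a J h => by
    simp only [map_add, coord_ofFun h]
    split_ifs <;> simp
  map_smul' r x := ext fun a J h => by
    simp only [map_smul, coord_ofFun h, RingHom.id_apply]
    split_ifs <;> simp

open scoped Classical in
/-- The action of an arrow of type `t` with target `j`, with scalar `r`. -/
def actArrow (F : PyramidFrame (m := m) d) (base : A → PyramidVertex n m) (t : Fin (n + 1)) (r : k)
    (j : PyramidVertex n m) : Module.End k (CubeModule F base) where
  toFun x := ofFun F base fun a J =>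
    if t ∈ J ∧ moveAll (base a).1 J = j.1 then r * coord a (J.erase t) x else 0
  map_add' x y := ext fun a J h => by
    simp only [map_add, coord_ofFun h]
    split_ifs <;> simp [mul_add]
  map_smul' r x := ext fun a J h => by
    simp only [map_smul, coord_ofFun h, RingHom.id_apply]
    split_ifs
    · simp only [smul_eq_mul]; ring
    · simp

open scoped Classical in
theorem coord_actIdem (j : PyramidVertex n m) (a : A) (J : Finset (Fin (n + 1)))
    (x : CubeModule F base) :
    coord a J (actIdem F base j x) = if moveAll (base a).1 J = j.1 then coord a J x else 0 := by
  by_cases h : IsPyramidVertex n m (moveAll (base a).1 J)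
  · exact coord_ofFun (F := F)
      (f := fun a J => if moveAll (base a).1 J = j.1 then coord a J x else 0) h
  · simp [coord_of_not h]

open scoped Classical in
theorem coord_actArrow (t : Fin (n + 1)) (r : k) (j : PyramidVertex n m) (a : A)
    (J : Finset (Fin (n + 1))) (x : CubeModule F base) :
    coord a J (actArrow F base t r j x)
      = if t ∈ J ∧ moveAll (base a).1 J = j.1 then r * coord a (J.erase t) x else 0 := by
  by_cases h : IsPyramidVertex n m (moveAll (base a).1 J)
  · exact coord_ofFun (F := F) (f := fun a J =>
      if t ∈ J ∧ moveAll (base a).1 J = j.1 then r * coord a (J.erase t) x else 0) h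
  · rw [coord_of_not h, if_neg]
    rintro ⟨-, h'⟩
    exact h (h' ▸ j.2)

/-- The action of a path. -/
def actPath (F : PyramidFrame (m := m) d) (base : A → PyramidVertex n m) {i : PyramidVertex n m} :
    ∀ {j : PyramidVertex n m}, Quiver.Path i j → Module.End k (CubeModule F base)
  | _, .nil => actIdem F base i
  | _, @Quiver.Path.cons _ _ _ j l p a =>
    actArrow F base (arrowType a) (F.c (arrowType a) j.1) l * actPath F base p

theorem actIdem_mul_actPath {i j : PyramidVertex n m} (p : Quiver.Path i j) :
    actIdem F base j * actPath F base p = actPath F base p := by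
  cases p with
  | nil =>
    refine LinearMap.ext fun x => ext fun a J _ => ?_
    simp only [actPath, Module.End.mul_apply, coord_actIdem]
    split_ifs <;> rfl
  | cons p a =>
    refine LinearMap.ext fun x => ext fun a J _ => ?_
    simp only [actPath, Module.End.mul_apply, coord_actIdem, coord_actArrow]
    split_ifs <;> simp_all

theorem actPath_comp {i j l : PyramidVertex n m} (p : Quiver.Path i j) (q : Quiver.Path j l) :
    actPath F base (p.comp q) = actPath F base q * actPath F base p := by
  induction q with
  | nil => exact (actIdem_mul_actPath p).symm
  | cons q a ih => rw [Quiver.Path.comp_cons, actPath, ih, ← mul_assoc]; rfl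

theorem actPath_mul_actIdem {i j : PyramidVertex n m} (p : Quiver.Path i j) :
    actPath F base p * actIdem F base i = actPath F base p := by
  have := actPath_comp (F := F) (base := base) Quiver.Path.nil p
  rw [Quiver.Path.nil_comp] at this
  exact this.symm

theorem actIdem_mul_actIdem_of_ne {i j : PyramidVertex n m} (h : i ≠ j) :
    actIdem F base i * actIdem F base j = 0 := by
  refine LinearMap.ext fun x => ext fun a J _ => ?_
  simp only [Module.End.mul_apply, coord_actIdem, LinearMap.zero_apply, map_zero]
  split_ifs with h1 h2
  · exact absurd (Subtype.ext (h1.symm.trans h2)) h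
  · rfl
  · rfl

theorem actPath_mul_actPath_of_ne {i j i' j' : PyramidVertex n m} (p : Quiver.Path i j)
    (q : Quiver.Path i' j') (h : j' ≠ i) : actPath F base p * actPath F base q = 0 := by
  rw [← actPath_mul_actIdem p, ← actIdem_mul_actPath q, mul_assoc, ← mul_assoc (actIdem F base i),
    actIdem_mul_actIdem_of_ne h.symm, zero_mul, mul_zero]

/-- The representation of the path algebra as a linear map. -/
def repLinear (F : PyramidFrame (m := m) d) (base : A → PyramidVertex n m) :
    PathAlgebra k (PyramidVertex n m) →ₗ[k] Module.End k (CubeModule F base) :=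
  (PathAlgebra.basis k).constr k fun p => actPath F base p.2.2

theorem repLinear_ofPath {i j : PyramidVertex n m} (p : Quiver.Path i j) :
    repLinear F base (PathAlgebra.ofPath k p) = actPath F base p :=
  Module.Basis.constr_basis _ _ _ _

theorem sum_actIdem : ∑ j, actIdem F base j = 1 := by
  refine LinearMap.ext fun x => ext fun a J h => ?_
  rw [LinearMap.sum_apply, map_sum, Finset.sum_eq_single (PyramidVertex.mk _ h)]
  · rw [coord_actIdem]
    exact if_pos rfl
  · intro j _ hj
    rw [coord_actIdem, if_neg]
    exact fun h' => hj (Subtype.ext h'.symm)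
  · simp

/-- The representation of the path algebra. -/
def repPath (F : PyramidFrame (m := m) d) (base : A → PyramidVertex n m) :
    PathAlgebra k (PyramidVertex n m) →ₐ[k] Module.End k (CubeModule F base) :=
  AlgHom.ofLinearMap (repLinear F base)
    (by
      rw [PathAlgebra.one_def, map_sum, ← sum_actIdem]
      exact Finset.sum_congr rfl fun j _ => repLinear_ofPath _)
    (by
      intro x y
      induction x using PathAlgebra.induction with
      | h0 => simp
      | ha x x' hx hx' => simp [add_mul, hx, hx']
      | hs r x hx => simp [hx]
      | @hp i j p =>
        induction y using PathAlgebra.induction with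
        | h0 => simp
        | ha y y' hy hy' => simp [mul_add, hy, hy']
        | hs r y hy => simp [hy]
        | @hp i' j' q =>
          by_cases h : j' = i
          · subst h
            rw [PathAlgebra.ofPath_mul_ofPath]
            simp only [repLinear_ofPath, actPath_comp]
          · rw [PathAlgebra.ofPath_mul_ofPath_of_ne _ _ h]
            simp only [repLinear_ofPath, actPath_mul_actPath_of_ne _ _ h, map_zero])

theorem repPath_ofPath {i j : PyramidVertex n m} (p : Quiver.Path i j) :
    repPath F base (PathAlgebra.ofPath k p) = actPath F base p := repLinear_ofPath p

/-- Removing the types from `J` one by one traces the path backwards from `l`, so the conditions at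
`j` and `i` follow from the one at `l`. -/
theorem actPath_two {i j l : PyramidVertex n m} (a : i ⟶ j) (b : j ⟶ l) (x : CubeModule F base)
    (a0 : A) (J : Finset (Fin (n + 1))) :
    coord a0 J (actPath F base (a.toPath.comp b.toPath) x) =
      open scoped Classical in
      if arrowType b ∈ J ∧ arrowType a ∈ J.erase (arrowType b) ∧ moveAll (base a0).1 J = l.1 then
        (F.c (arrowType b) j.1 * F.c (arrowType a) i.1) *
          coord a0 ((J.erase (arrowType b)).erase (arrowType a)) x else 0 := by
  have ha : j.1 = i.1 + pyramidStep n (arrowType a) := a.2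
  have hb : l.1 = j.1 + pyramidStep n (arrowType b) := b.2
  rw [actPath_comp, Module.End.mul_apply]
  simp only [Quiver.Hom.toPath, actPath, Module.End.mul_apply, coord_actArrow, coord_actIdem]
  by_cases h1 : arrowType b ∈ J
  swap
  · simp [h1]
  by_cases h3 : moveAll (base a0).1 J = l.1
  swap
  · simp [h3]
  have e1 : moveAll (base a0).1 (J.erase (arrowType b)) = j.1 := by
    have := moveAll_erase (base a0).1 h1
    rw [h3, hb] at this
    exact add_right_cancel this
  by_cases h2 : arrowType a ∈ J.erase (arrowType b)
  swap
  · simp only [h2, false_and, and_false, if_false, mul_zero, ite_self]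
  have e2 : moveAll (base a0).1 ((J.erase (arrowType b)).erase (arrowType a)) = i.1 := by
    have := moveAll_erase (base a0).1 h2
    rw [e1, ha] at this
    exact add_right_cancel this
  rw [if_pos ⟨h1, h3⟩, if_pos e1, if_pos ⟨h2, e1⟩, if_pos e2, if_pos ⟨h1, h2, h3⟩, mul_assoc]

/-- Both sides of a square remove the same two types, with coefficients identified by the gauge
equation. The path `γ_t γ_t` would have to remove `t` twice. -/
theorem repPath_relation (x : PathAlgebra k (PyramidVertex n m)) (hx : x ∈ stableRelations d) :
    repPath F base x = 0 := by
  refine LinearMap.ext fun y => ext fun a0 J _ => ?_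
  rw [LinearMap.zero_apply, map_zero]
  rcases hx with ⟨i, j, j', l, a, b, a', b', h1, h2, h3, rfl⟩ | ⟨i, j, l, a, b, h, rfl⟩
  · have ha : j.1 = i.1 + pyramidStep n (arrowType a) := a.2
    have hb : l.1 = j.1 + pyramidStep n (arrowType b) := b.2
    have ha' : j'.1 = i.1 + pyramidStep n (arrowType a') := a'.2
    have hg := F.gauge (arrowType a) (arrowType a') i.1 h3 i.2 (ha ▸ j.2) (ha' ▸ j'.2)
      (by rw [← ha, ← h1, ← hb]; exact l.2)
    rw [← ha, ← ha'] at hg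
    rw [map_sub, map_smul, repPath_ofPath, repPath_ofPath, LinearMap.sub_apply, map_sub,
      LinearMap.smul_apply, map_smul, actPath_two, actPath_two, h1, h2]
    have hiff : (arrowType a' ∈ J ∧ arrowType a ∈ J.erase (arrowType a') ∧
        moveAll (base a0).1 J = l.1) ↔ (arrowType a ∈ J ∧ arrowType a' ∈ J.erase (arrowType a) ∧
        moveAll (base a0).1 J = l.1) := by
      simp only [Finset.mem_erase]
      tauto
    simp only [hiff, Finset.erase_right_comm (a := arrowType a)]
    split_ifs with h
    · rw [smul_eq_mul, ← mul_assoc, ← mul_assoc, hg, sub_self]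
    · simp
  · rw [repPath_ofPath, actPath_two, h, if_neg]
    simp

/-- The representation of the algebra of the stable pyramid. -/
def rep (F : PyramidFrame (m := m) d) (base : A → PyramidVertex n m) :
    PyramidAlgebra m d →ₐ[k] Module.End k (CubeModule F base) :=
  RingQuot.liftAlgHom k ⟨repPath F base, fun x y h => by
    rw [h.2, map_zero, repPath_relation x h.1]⟩

theorem rep_toBound (x : PathAlgebra k (PyramidVertex n m)) :
    rep F base (toBound _ x) = repPath F base x :=
  RingQuot.liftAlgHom_mkAlgHom_apply k _ _ _

instance : Module (PyramidAlgebra m d) (CubeModule F base) :=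
  Module.compHom (CubeModule F base) (rep F base).toRingHom

theorem smul_eq_rep (a : PyramidAlgebra m d) (x : CubeModule F base) : a • x = rep F base a x := rfl

instance : IsScalarTower k (PyramidAlgebra m d) (CubeModule F base) where
  smul_assoc r a x := by
    rw [smul_eq_rep, map_smul]
    rfl

open scoped Classical in
theorem coord_boundIdem_smul (j : PyramidVertex n m) (a : A) (J : Finset (Fin (n + 1)))
    (x : CubeModule F base) : coord a J (boundIdem (stableRelations d) j • x)
      = if moveAll (base a).1 J = j.1 then coord a J x else 0 := by
  rw [smul_eq_rep, boundIdem, rep_toBound, PathAlgebra.idem, repPath_ofPath]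
  exact coord_actIdem _ _ _ _

-- The rescaling in `gen` cancels the scalar built into `actPath`, so a rescaled arrow adds its type
-- to `J` with coefficient one.
open scoped Classical in
theorem coord_gen_smul (t : Fin (n + 1)) (l : Fin n → ℤ) (a : A) (J : Finset (Fin (n + 1)))
    (hJ : IsPyramidVertex n m (moveAll (base a).1 J)) (x : CubeModule F base) :
    coord a J (F.g t l • x)
      = if t ∈ J ∧ moveAll (base a).1 (J.erase t) = l then coord a (J.erase t) x else 0 := by
  by_cases h : IsPyramidVertex n m l ∧ IsPyramidVertex n m (l + pyramidStep n t)
  · have e : coord a J (F.g t l • x) = (F.c t l)⁻¹.val * (if t ∈ J ∧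
        moveAll (base a).1 J = l + pyramidStep n t then
        (F.c t l).val * coord a (J.erase t) (actIdem F base (.mk l h.1) x) else 0) := by
      rw [PyramidFrame.g, gen, dif_pos h, smul_assoc, map_smul, smul_eq_rep, rep_toBound,
        repPath_ofPath, smul_eq_mul]
      congr 1
      exact coord_actArrow _ _ _ _ _ _
    rw [e]
    by_cases ht : t ∈ J
    · have h1 : moveAll (base a).1 J = l + pyramidStep n t ↔
          moveAll (base a).1 (J.erase t) = l := by
        rw [← moveAll_erase _ ht, add_left_inj]
      simp only [ht, true_and, h1]
      split_ifs with h2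
      · rw [coord_actIdem, ← mul_assoc, Units.inv_mul, one_mul]
        exact if_pos h2
      · rw [mul_zero]
    · simp [ht]
  · rw [PyramidFrame.g, gen_of_not _ _ h, zero_smul, map_zero]
    split_ifs with h1
    · rw [coord_of_not]
      intro h2
      refine h ⟨h1.2 ▸ h2, ?_⟩
      rw [← h1.2, moveAll_erase _ h1.1]
      exact hJ
    · rfl

open scoped Classical in
/-- The basis element at `(a, J)`. -/
def single (F : PyramidFrame (m := m) d) (base : A → PyramidVertex n m) (a : A)
    (J : Finset (Fin (n + 1))) : CubeModule F base :=
  ofFun F base fun a' J' => if a' = a ∧ J' = J then 1 else 0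

open scoped Classical in
theorem coord_single (a a' : A) (J J' : Finset (Fin (n + 1)))
    (h : IsPyramidVertex n m (moveAll (base a').1 J')) :
    coord a' J' (single F base a J) = if a' = a ∧ J' = J then 1 else 0 := coord_ofFun h

theorem gen_smul_single (a : A) (J : Finset (Fin (n + 1))) (t : Fin (n + 1)) (ht : t ∉ J)
    (hJ : IsPyramidVertex n m (moveAll (base a).1 J)) :
    F.g t (moveAll (base a).1 J) • single F base a J = single F base a (insert t J) := by
  refine ext fun a' K hK => ?_
  rw [coord_gen_smul _ _ _ _ hK, coord_single _ _ _ _ hK]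
  by_cases h : a' = a ∧ K = insert t J
  · obtain ⟨rfl, rfl⟩ := h
    rw [Finset.erase_insert ht, coord_single _ _ _ _ hJ]
    simp
  · rw [if_neg h]
    split_ifs with h1
    · rw [coord_single _ _ _ _ (h1.2 ▸ hJ), if_neg]
      rintro ⟨rfl, h2⟩
      exact h ⟨rfl, by rw [← h2, Finset.insert_erase h1.1]⟩
    · rfl

theorem boundIdem_smul_single (a : A) :
    boundIdem (stableRelations d) (base a) • single F base a ∅ = single F base a ∅ := by
  refine ext fun a' K hK => ?_
  rw [coord_boundIdem_smul, coord_single _ _ _ _ hK]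
  split_ifs with h1 h2 h2
  · rfl
  · rfl
  · obtain ⟨rfl, rfl⟩ := h2
    exact absurd (moveAll_empty _) h1
  · rfl

theorem b_smul_single (a : A) (J : Finset (Fin (n + 1)))
    (hJ : IsPyramidVertex n m (moveAll (base a).1 J)) :
    F.b (base a) J • single F base a ∅ = single F base a J := by
  refine F.set_induction (P := fun J => F.b (base a) J • single F base a ∅ = single F base a J)
    ?_ ?_ J hJ
  · rw [F.b_empty, boundIdem_smul_single]
  · intro J t ht h1 h2 ih
    rw [← F.gen_mul_b _ _ _ ht h1 h2, mul_smul, ih, gen_smul_single a J t ht h1]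

theorem sum_coord_smul_single [Fintype A] (x : CubeModule F base) :
    ∑ a, ∑ J, coord a J x • single F base a J = x := by
  classical
  refine ext fun a J h => ?_
  simp only [map_sum, map_smul, coord_single _ _ _ _ h]
  rw [Finset.sum_eq_single a, Finset.sum_eq_single J]
  · simp
  · intro K _ hK
    simp [hK.symm]
  · simp
  · intro a' _ ha
    simp [ha.symm]
  · simp

end CubeModule

end CubeModules

/-! ### Bound paths and the axioms of a translation quiver -/

section Translation

variable {k : Type u} [Field k] {n m : ℕ}
  {d : Fin (n + 1) → Fin (n + 1) → (Fin n → ℤ) → k}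

namespace PyramidFrame

variable (F : PyramidFrame (m := m) d)

/-- On the cube module with a single base vertex `i`, the element carries the generator at `∅` to
the basis element at `J`. -/
theorem b_ne_zero (i : PyramidVertex n m) (J : Finset (Fin (n + 1)))
    (hJ : IsPyramidVertex n m (moveAll i.1 J)) : F.b i J ≠ 0 := by
  intro h
  have h1 := CubeModule.b_smul_single (F := F) (base := fun _ : Unit => i) () J hJ
  rw [h, zero_smul] at h1
  have h2 := CubeModule.coord_single (F := F) (base := fun _ : Unit => i) () () J J hJ
  rw [← h1, map_zero] at h2
  simp at h2

/-- `J` is the set of types along the path. A repeated type kills it, so in the nonzero case the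
length equals the cardinality. -/
theorem toBound_path {i j : PyramidVertex n m} (p : Quiver.Path i j) :
    toBound (stableRelations d) (PathAlgebra.ofPath k p) = 0 ∨
      ∃ (r : k) (J : Finset (Fin (n + 1))), r ≠ 0 ∧ J.card = p.length ∧ j.1 = moveAll i.1 J ∧
        toBound (stableRelations d) (PathAlgebra.ofPath k p) = r • F.b i J := by
  induction p with
  | nil =>
    refine Or.inr ⟨1, ∅, one_ne_zero, rfl, (moveAll_empty _).symm, ?_⟩
    rw [F.b_empty, one_smul]
    rfl
  | @cons j l p a ih =>
    have ha : l.1 = j.1 + pyramidStep n (arrowType a) := a.2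
    rw [toBound_cons]
    rcases ih with h | ⟨r, J, hr, hc, hj, h⟩
    · exact Or.inl (by rw [h, mul_zero])
    · rw [h, toBound_arrow d F.c, smul_mul_smul_comm, hj]
      have hJ : IsPyramidVertex n m (moveAll i.1 J) := hj ▸ j.2
      by_cases ht : arrowType a ∈ J
      · left
        rw [F.gen_mul_b_of_mem i J _ ht hJ, smul_zero]
      · right
        have hl : l.1 = moveAll i.1 (insert (arrowType a) J) := by
          rw [moveAll_insert _ ht, ← hj, ha]
        refine ⟨_, insert (arrowType a) J,
          mul_ne_zero (F.c (arrowType a) (moveAll i.1 J)).ne_zero hr, ?_, hl, ?_⟩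
        · rw [Finset.card_insert_of_notMem ht, hc]
          rfl
        · rw [F.gen_mul_b i J _ ht hJ (hl ▸ l.2)]

theorem exists_path (i : PyramidVertex n m) (J : Finset (Fin (n + 1))) (j : PyramidVertex n m)
    (hj : j.1 = moveAll i.1 J) :
    ∃ p : Quiver.Path i j, p.length = J.card ∧ ∃ r : k, r ≠ 0 ∧
      toBound (stableRelations d) (PathAlgebra.ofPath k p) = r • F.b i J := by
  have hJ : IsPyramidVertex n m (moveAll i.1 J) := hj ▸ j.2
  revert j
  refine F.set_induction (P := fun J => ∀ j : PyramidVertex n m, j.1 = moveAll i.1 J →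
    ∃ p : Quiver.Path i j, p.length = J.card ∧ ∃ r : k, r ≠ 0 ∧
      toBound (stableRelations d) (PathAlgebra.ofPath k p) = r • F.b i J) ?_ ?_ J hJ
  · intro j hj
    rw [moveAll_empty] at hj
    obtain rfl : j = i := Subtype.ext hj
    exact ⟨Quiver.Path.nil, rfl, 1, one_ne_zero, by rw [F.b_empty, one_smul]; rfl⟩
  · intro J t ht h1 h2 ih l hl
    obtain ⟨p, hp, r, hr, h⟩ := ih (.mk _ h1) rfl
    rw [moveAll_insert _ ht] at hl
    let a : PyramidVertex.mk _ h1 ⟶ l := ⟨t, hl⟩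
    refine ⟨p.cons a, ?_, _, mul_ne_zero (F.c t (moveAll i.1 J)).ne_zero hr, ?_⟩
    · rw [Finset.card_insert_of_notMem ht, ← hp]
      rfl
    · rw [toBound_cons, toBound_arrow d F.c, h, smul_mul_smul_comm, ← F.gen_mul_b i J t ht h1 h2]
      rfl

/-- Endpoints and length determine `J` by `eq_of_moveAll_eq`, so all paths counted here have images
on one line. Linear combinations then behave like single paths. -/
theorem toBound_pathSpan {i j : PyramidVertex n m} {t : ℕ}
    {y : PathAlgebra k (PyramidVertex n m)} (hy : y ∈ pathSpan k i j t) :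
    toBound (stableRelations d) y = 0 ∨
      ∃ (r : k) (J : Finset (Fin (n + 1))), r ≠ 0 ∧ J.card = t ∧ j.1 = moveAll i.1 J ∧
        toBound (stableRelations d) y = r • F.b i J := by
  by_cases hJ : ∃ J : Finset (Fin (n + 1)), J.card = t ∧ j.1 = moveAll i.1 J
  · obtain ⟨J, hc, hj⟩ := hJ
    have h : pathSpan k i j t ≤ (Submodule.span k {F.b i J}).comap
        (toBound (stableRelations d)).toLinearMap := by
      refine Submodule.span_le.2 ?_
      rintro _ ⟨p, hp, rfl⟩
      rw [SetLike.mem_coe, Submodule.mem_comap, AlgHom.toLinearMap_apply]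
      rcases F.toBound_path p with h | ⟨r, K, -, hc', hj', h⟩
      · rw [h]
        exact Submodule.zero_mem _
      · obtain rfl : J = K := eq_of_moveAll_eq F.hn (hj.symm.trans hj') (by rw [hc, hc', hp])
        rw [h]
        exact Submodule.smul_mem _ _ (Submodule.mem_span_singleton_self _)
    obtain ⟨r, hr⟩ := Submodule.mem_span_singleton.1 (h hy)
    by_cases h0 : r = 0
    · left
      rw [h0, zero_smul] at hr
      exact hr.symm
    · exact Or.inr ⟨r, J, h0, hc, hj, hr.symm⟩
  · left
    have h : pathSpan k i j t ≤ LinearMap.ker (toBound (stableRelations d)).toLinearMap := by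
      refine Submodule.span_le.2 ?_
      rintro _ ⟨p, hp, rfl⟩
      rw [SetLike.mem_coe, LinearMap.mem_ker, AlgHom.toLinearMap_apply]
      rcases F.toBound_path p with h | ⟨r, K, -, hc', hj', h⟩
      · exact h
      · exact absurd ⟨K, hc'.trans hp, hj'⟩ hJ
    exact h hy

include F in
theorem degreePart_eq_bot (t : ℕ) (ht : n + 1 < t) :
    degreePart (stableRelations (m := m) d) t = ⊥ := by
  rw [degreePart, Submodule.span_eq_bot]
  rintro _ ⟨i, j, p, hp, rfl⟩
  rcases F.toBound_path p with h | ⟨r, J, -, hc, -⟩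
  · exact h
  · have := J.card_le_univ
    rw [Fintype.card_fin] at this
    omega

include F in
theorem not_linearIndependent (x : PyramidVertex n m) (p q : Quiver.Path x x)
    (hp : p.length = n + 1) (hq : q.length = n + 1)
    (hp' : IsBound (stableRelations d) (PathAlgebra.ofPath k p))
    (hq' : IsBound (stableRelations d) (PathAlgebra.ofPath k q)) :
    ¬ LinearIndependent k ![toBound (stableRelations d) (PathAlgebra.ofPath k p),
      toBound (stableRelations d) (PathAlgebra.ofPath k q)] := by
  intro hli
  have key : ∀ p : Quiver.Path x x,
      p.length = n + 1 → IsBound (stableRelations d) (PathAlgebra.ofPath k p) →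
      ∃ r : k, r ≠ 0 ∧ toBound (stableRelations d) (PathAlgebra.ofPath k p)
        = r • F.b x Finset.univ := by
    intro p hl hp
    rcases F.toBound_path p with h | ⟨r, J, hr, hc, -, h⟩
    · exact absurd h hp
    · obtain rfl : J = Finset.univ := by
        rw [← Finset.card_eq_iff_eq_univ, hc, hl, Fintype.card_fin]
      exact ⟨r, hr, h⟩
  obtain ⟨r, hr, h1⟩ := key p hp hp'
  obtain ⟨s, -, h2⟩ := key q hq hq'
  have := (LinearIndependent.pair_iff.1 hli) s (-r) (by
    rw [h1, h2, smul_smul, smul_smul, ← add_smul, show s * r + -r * s = 0 by ring, zero_smul])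
  exact hr (neg_eq_zero.1 this.2)

-- The missing factor runs through the types in the complement of `J`. The product is a nonzero
-- multiple of the closed element with all types.
include F in
theorem exists_mul_bound (x j : PyramidVertex n m) {t : ℕ}
    {y : PathAlgebra k (PyramidVertex n m)} (hy : y ∈ pathSpan k j x t)
    (hb : IsBound (stableRelations d) y) :
    ∃ q : Quiver.Path x j, q.length = n + 1 - t ∧
      IsBound (stableRelations d) (y * PathAlgebra.ofPath k q) := by
  rcases F.toBound_pathSpan hy with h | ⟨r, J, hr, hc, hj, h⟩
  · exact absurd h hb
  · have hj' : j.1 = moveAll x.1 Jᶜ := by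
      rw [hj, moveAll_moveAll _ disjoint_compl_right, Finset.union_compl, moveAll_univ F.hn]
    obtain ⟨q, hq, s, hs, h'⟩ := F.exists_path x Jᶜ j hj'
    refine ⟨q, by rw [hq, Finset.card_compl, hc, Fintype.card_fin], ?_⟩
    have e := F.b_mul_b x j Jᶜ J disjoint_compl_left hj' (hj ▸ x.2)
    rw [IsBound, map_mul, h, h', smul_mul_smul_comm, e]
    refine smul_ne_zero (mul_ne_zero hr hs) (F.b_ne_zero _ _ ?_)
    rw [Finset.union_comm, Finset.union_compl, moveAll_univ F.hn]
    exact x.2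

include F in
theorem exists_bound_mul (x j : PyramidVertex n m) {t : ℕ}
    {y : PathAlgebra k (PyramidVertex n m)} (hy : y ∈ pathSpan k x j t)
    (hb : IsBound (stableRelations d) y) :
    ∃ p : Quiver.Path j x, p.length = n + 1 - t ∧
      IsBound (stableRelations d) (PathAlgebra.ofPath k p * y) := by
  rcases F.toBound_pathSpan hy with h | ⟨r, J, hr, hc, hj, h⟩
  · exact absurd h hb
  · have hj' : x.1 = moveAll j.1 Jᶜ := by
      rw [hj, moveAll_moveAll _ disjoint_compl_right, Finset.union_compl, moveAll_univ F.hn]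
    obtain ⟨q, hq, s, hs, h'⟩ := F.exists_path j Jᶜ x hj'
    refine ⟨q, by rw [hq, Finset.card_compl, hc, Fintype.card_fin], ?_⟩
    have e := F.b_mul_b x j J Jᶜ disjoint_compl_right hj (hj' ▸ x.2)
    rw [IsBound, map_mul, h, h', smul_mul_smul_comm, e]
    refine smul_ne_zero (mul_ne_zero hs hr) (F.b_ne_zero _ _ ?_)
    rw [Finset.union_compl, moveAll_univ F.hn]
    exact x.2

include F in
theorem isTranslationQuiver :
    IsTranslationQuiver n (stableRelations (m := m) d) ∅ ∅
      (Equiv.refl ((∅ : Set (PyramidVertex n m))ᶜ : Set (PyramidVertex n m))) where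
  maximal i j p hp := by
    rcases F.toBound_path p with h | ⟨r, J, hr, hc, hj, h⟩
    · exact absurd h hp.1
    · have hJ : J = Finset.univ := by
        by_contra hne
        -- A bound path that misses a type can be prolonged by some legal missing type and stays
        -- bound, contrary to maximality.
        obtain ⟨t, ht, h'⟩ := exists_addable F.hn (le_trans (by norm_num) F.hm) i.2 hne (hj ▸ j.2)
        have h'' := h'
        rw [moveAll_insert _ ht, ← hj] at h''
        let a : j ⟶ PyramidVertex.mk _ h'' := ⟨t, rfl⟩
        have := (hp.2 i _ Quiver.Path.nil a.toPath (by
          rw [IsBound, Quiver.Path.nil_comp, toBound_comp, h, toBound_arrow d F.c,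
            smul_mul_smul_comm]
          refine smul_ne_zero (mul_ne_zero (Units.ne_zero _) hr) ?_
          have e := F.gen_mul_b i J t ht (hj ▸ j.2) h'
          rw [← hj] at e
          change gen d F.c m t j.1 * F.b i J ≠ 0
          rw [e]
          exact F.b_ne_zero _ _ h')).2
        exact absurd this one_ne_zero
      subst hJ
      rw [moveAll_univ F.hn] at hj
      refine ⟨by rw [← hc, Finset.card_univ, Fintype.card_fin], ⟨j, id⟩, rfl, Subtype.ext hj⟩
  dependent x p q hp hq hp' hq' := F.not_linearIndependent x p q hp hq hp' hq'
  extend_right x j _ _ _ hy hb := F.exists_mul_bound x j hy hb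
  extend_left x j _ _ _ hy hb := F.exists_bound_mul x j hy hb

/-- A `k`-linear map that commutes with the generators of the algebra is linear over the
algebra. -/
def toLinear {M N : Type*} [AddCommGroup M] [AddCommGroup N] [Module k M] [Module k N]
    [Module (PyramidAlgebra m d) M] [Module (PyramidAlgebra m d) N]
    [IsScalarTower k (PyramidAlgebra m d) M] [IsScalarTower k (PyramidAlgebra m d) N]
    (φ : M →ₗ[k] N)
    (hidem : ∀ (j : PyramidVertex n m) (x : M),
      φ (boundIdem (stableRelations d) j • x) = boundIdem (stableRelations d) j • φ x)
    (hgen : ∀ t l (x : M), φ (F.g t l • x) = F.g t l • φ x) : M →ₗ[PyramidAlgebra m d] N where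
  toFun := φ
  map_add' := φ.map_add
  map_smul' a := by
    refine pyramidAlgebra_induction d F.c (P := fun a => ∀ x, φ (a • x) = a • φ x) ?_ ?_ ?_ hidem
      ?_ a
    · intro x
      rw [zero_smul, zero_smul, map_zero]
    · intro a b ha hb x
      rw [add_smul, add_smul, map_add, ha, hb]
    · intro r a ha x
      rw [smul_assoc, smul_assoc, map_smul, ha]
    · intro t l a ha x
      rw [mul_smul, mul_smul, hgen, ha]

end PyramidFrame

/-! ### Projectivity, grading and radical of cube modules -/

namespace CubeModule

variable {F : PyramidFrame (m := m) d} {A : Type} {base : A → PyramidVertex n m}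

theorem sum_ite_erase {M : Type*} [AddCommMonoid M] (t : Fin (n + 1))
    (f : Finset (Fin (n + 1)) → Finset (Fin (n + 1)) → M) :
    ∑ J, (if t ∈ J then f (J.erase t) J else 0) = ∑ J, if t ∈ J then 0 else f J (insert t J) := by
  have h : ∀ J, (if t ∈ J then 0 else f J (insert t J))
      = if t ∉ J then f J (insert t J) else 0 := fun J => by split_ifs <;> rfl
  simp only [h]
  rw [← Finset.sum_filter, ← Finset.sum_filter]
  refine Finset.sum_nbij' (fun J => J.erase t) (fun J => insert t J) ?_ ?_ ?_ ?_ ?_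
  · simp
  · simp
  · intro J hJ
    simp only [Finset.mem_filter, Finset.mem_univ, true_and] at hJ
    exact Finset.insert_erase hJ
  · intro J hJ
    simp only [Finset.mem_filter, Finset.mem_univ, true_and] at hJ
    exact Finset.erase_insert hJ
  · intro J hJ
    simp only [Finset.mem_filter, Finset.mem_univ, true_and] at hJ
    rw [Finset.insert_erase hJ]

/-- The map to the algebra that sends the basis element at `(a, J)` to `b (base a) J`. -/
def toAlgebra (F : PyramidFrame (m := m) d) (base : A → PyramidVertex n m) (a : A) :
    CubeModule F base →ₗ[PyramidAlgebra m d] PyramidAlgebra m d :=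
  F.toLinear (∑ J, (coord a J).smulRight (F.b (base a) J))
    (by
      intro j x
      simp only [LinearMap.sum_apply, LinearMap.smulRight_apply, Finset.smul_sum]
      refine Finset.sum_congr rfl fun J _ => ?_
      rw [coord_boundIdem_smul, smul_eq_mul, mul_smul_comm]
      by_cases hJ : IsPyramidVertex n m (moveAll (base a).1 J)
      · split_ifs with h
        · rw [F.boundIdem_mul_b _ _ _ hJ h.symm]
        · rw [F.boundIdem_mul_b_of_ne _ _ _ hJ (Ne.symm h), smul_zero, zero_smul]
      · rw [coord_of_not hJ, ite_self, zero_smul, zero_smul])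
    (by
      classical
      intro t l x
      simp only [LinearMap.sum_apply, LinearMap.smulRight_apply, Finset.smul_sum]
      -- Contribution of the step from `K` to `J`. One side of the claim sums over targets and the
      -- other over sources; `sum_ite_erase` matches them.
      let f : Finset (Fin (n + 1)) → Finset (Fin (n + 1)) → PyramidAlgebra m d := fun K J =>
        if IsPyramidVertex n m (moveAll (base a).1 J) ∧ moveAll (base a).1 K = l then
          coord a K x • F.b (base a) J else 0
      have e1 : ∀ J, coord a J (F.g t l • x) • F.b (base a) J
          = if t ∈ J then f (J.erase t) J else 0 := by
        intro J
        by_cases hJ : IsPyramidVertex n m (moveAll (base a).1 J)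
        · rw [coord_gen_smul _ _ _ _ hJ]
          simp only [f, hJ, true_and]
          split_ifs <;> simp_all
        · rw [coord_of_not hJ]
          simp [f, hJ]
      have e2 : ∀ J, F.g t l • coord a J x • F.b (base a) J
          = if t ∈ J then 0 else f J (insert t J) := by
        intro J
        rw [smul_eq_mul, mul_smul_comm]
        by_cases hJ : IsPyramidVertex n m (moveAll (base a).1 J)
        swap
        · rw [coord_of_not hJ, zero_smul]
          simp [f, coord_of_not hJ]
        by_cases hl : moveAll (base a).1 J = l
        swap
        · rw [F.gen_mul_b_of_ne _ _ _ _ hJ (Ne.symm hl), smul_zero]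
          simp [f, hl]
        subst hl
        split_ifs with ht
        · rw [F.gen_mul_b_of_mem _ _ _ ht hJ, smul_zero]
        · by_cases h' : IsPyramidVertex n m (moveAll (base a).1 (insert t J))
          · rw [F.gen_mul_b _ _ _ ht hJ h']
            simp [f, h']
          · rw [PyramidFrame.g, gen_of_not _ _ (by rw [← moveAll_insert _ ht]; tauto), zero_mul,
              smul_zero]
            simp [f, h']
      simp only [e1, e2]
      exact sum_ite_erase t f)

theorem toAlgebra_apply (a : A) (x : CubeModule F base) :
    toAlgebra F base a x = ∑ J, coord a J x • F.b (base a) J := by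
  change (∑ J, (coord a J).smulRight (F.b (base a) J)) x = _
  simp only [LinearMap.sum_apply, LinearMap.smulRight_apply]

theorem toAlgebra_smul_single [Fintype A] (x : CubeModule F base) :
    ∑ a, toAlgebra F base a x • single F base a ∅ = x := by
  conv_rhs => rw [← sum_coord_smul_single x]
  refine Finset.sum_congr rfl fun a _ => ?_
  rw [toAlgebra_apply, Finset.sum_smul]
  refine Finset.sum_congr rfl fun J _ => ?_
  by_cases hJ : IsPyramidVertex n m (moveAll (base a).1 J)
  · rw [smul_assoc, b_smul_single a J hJ]
  · rw [coord_of_not hJ, zero_smul, zero_smul, zero_smul]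

/-- The module is a retract of the free module on `A`: `toAlgebra` gives the section, and the
generators at `∅` give the retraction. -/
instance [Finite A] : Module.Projective (PyramidAlgebra m d) (CubeModule F base) := by
  cases nonempty_fintype A
  refine Module.Projective.of_split (LinearMap.pi (toAlgebra F base))
    (Fintype.linearCombination (PyramidAlgebra m d) fun a => single F base a ∅) ?_
  refine LinearMap.ext fun x => ?_
  rw [LinearMap.comp_apply, Fintype.linearCombination_apply]
  exact toAlgebra_smul_single x

theorem span_single_empty [Finite A] :
    Submodule.span (PyramidAlgebra m d) (Set.range fun a => single F base a ∅) = ⊤ := by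
  cases nonempty_fintype A
  refine eq_top_iff.2 fun x _ => ?_
  rw [← toAlgebra_smul_single x]
  exact Submodule.sum_mem _ fun a _ =>
    Submodule.smul_mem _ _ (Submodule.subset_span ⟨a, rfl⟩)

theorem gen_mem_degreePart (t : Fin (n + 1)) (l : Fin n → ℤ) :
    F.g t l ∈ degreePart (stableRelations d) 1 := by
  rw [PyramidFrame.g, gen]
  split_ifs
  · exact Submodule.smul_mem _ _ (Submodule.subset_span ⟨_, _, _, rfl, rfl⟩)
  · exact Submodule.zero_mem _

/-- The elements of degree `e`, where the basis element at `(a, J)` has degree `s + |J|`. -/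
def degAt (F : PyramidFrame (m := m) d) (base : A → PyramidVertex n m) (s e : ℕ) :
    AddSubgroup (CubeModule F base) where
  carrier := {x | ∀ a J, coord a J x ≠ 0 → s + J.card = e}
  zero_mem' a J h := absurd (map_zero _) h
  add_mem' {x y} hx hy a J h := by
    rw [map_add] at h
    by_cases h' : coord a J x = 0
    · rw [h', zero_add] at h
      exact hy a J h
    · exact hx a J h'
  neg_mem' {x} hx a J h := hx a J (by rwa [map_neg, neg_ne_zero] at h)

theorem smul_mem_degAt_of_field {s e : ℕ} {x : CubeModule F base} (r : k)
    (hx : x ∈ degAt F base s e) : r • x ∈ degAt F base s e := by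
  intro a J h
  rw [map_smul] at h
  exact hx a J (right_ne_zero_of_smul h)

theorem gen_smul_mem_degAt {s e : ℕ} {x : CubeModule F base} (t : Fin (n + 1)) (l : Fin n → ℤ)
    (hx : x ∈ degAt F base s e) : F.g t l • x ∈ degAt F base s (1 + e) := by
  intro a J h
  have hJ : IsPyramidVertex n m (moveAll (base a).1 J) := by
    by_contra h'
    exact h (coord_of_not h' _)
  rw [coord_gen_smul _ _ _ _ hJ] at h
  split_ifs at h with h1
  · have h2 := hx a _ h
    have h3 := Finset.card_erase_add_one h1.1
    omega
  · exact absurd rfl h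

theorem path_smul_mem_degAt {s e : ℕ} {x : CubeModule F base} {i j : PyramidVertex n m}
    (p : Quiver.Path i j) (hx : x ∈ degAt F base s e) :
    toBound (stableRelations d) (PathAlgebra.ofPath k p) • x ∈ degAt F base s (p.length + e) := by
  induction p with
  | nil =>
    intro a J h
    have e1 : coord a J (boundIdem (stableRelations d) i • x) ≠ 0 := h
    rw [coord_boundIdem_smul] at e1
    split_ifs at e1
    · rw [hx a J e1]
      exact (zero_add e).symm
    · exact absurd rfl e1
  | @cons j l p a ih =>
    rw [toBound_cons, toBound_arrow d F.c, mul_smul, smul_assoc]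
    have := smul_mem_degAt_of_field (F.c (arrowType a) j.1).val
      (gen_smul_mem_degAt (arrowType a) j.1 ih)
    rw [← add_assoc, add_comm 1] at this
    exact this

theorem smul_mem_degAt {s e c : ℕ} {x : CubeModule F base} {a : PyramidAlgebra m d}
    (ha : a ∈ degreePart (stableRelations d) c) (hx : x ∈ degAt F base s e) :
    a • x ∈ degAt F base s (c + e) := by
  induction ha using Submodule.span_induction with
  | mem a h =>
    obtain ⟨i, j, p, rfl, rfl⟩ := h
    exact path_smul_mem_degAt p hx
  | zero => rw [zero_smul]; exact AddSubgroup.zero_mem _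
  | add a b _ _ ha hb => rw [add_smul]; exact AddSubgroup.add_mem _ ha hb
  | smul r a _ ha => rw [smul_assoc]; exact smul_mem_degAt_of_field r ha

theorem isInternal_degAt (s : ℕ) : DirectSum.IsInternal (degAt F base s) := by
  classical
  -- The coordinate at `(a, J)` sees only the component of degree `s + |J|`. Both injectivity and
  -- surjectivity follow from this.
  have hcoe : ∀ (y : DirectSum ℕ fun e => degAt F base s e) (a : A) (J : Finset (Fin (n + 1))),
      coord a J (DirectSum.coeAddMonoidHom (degAt F base s) y)
        = coord a J (y (s + J.card) : CubeModule F base) := by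
    intro y a J
    induction y using DirectSum.induction_on with
    | zero => simp
    | of e x =>
      rw [DirectSum.coeAddMonoidHom_of]
      by_cases h : s + J.card = e
      · subst h
        rw [DirectSum.of_eq_same]
      · rw [DirectSum.of_eq_of_ne _ _ _ h]
        by_contra h'
        simp only [ZeroMemClass.coe_zero, map_zero] at h'
        exact h (x.2 a J h')
    | add y y' h h' => simp only [map_add, DirectSum.add_apply, AddSubgroup.coe_add, h, h']
  constructor
  · rw [injective_iff_map_eq_zero]
    intro y hy
    refine DFinsupp.ext fun e => Subtype.ext (ext fun a J hJ => ?_)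
    by_cases h : s + J.card = e
    · subst h
      have := hcoe y a J
      rw [hy, map_zero] at this
      rw [← this]
      exact (map_zero _).symm
    · by_contra h'
      refine h ((y e).2 a J fun h0 => h' ?_)
      rw [h0]
      exact (map_zero _).symm
  · intro x
    let piece : ∀ e : ℕ, degAt F base s e := fun e =>
      ⟨ofFun F base fun a J => if s + J.card = e then coord a J x else 0, fun a J h => by
        by_cases hJ : IsPyramidVertex n m (moveAll (base a).1 J)
        · rw [coord_ofFun hJ] at h
          by_contra h'
          exact h (if_neg h')
        · exact absurd (coord_of_not hJ _) h⟩
    -- No degree exceeds `s + (n + 1)`, because `J` has at most `n + 1` elements.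
    refine ⟨DFinsupp.mk (Finset.range (s + n + 2)) fun e => piece e, ext fun a J hJ => ?_⟩
    rw [hcoe]
    have h1 : s + J.card ∈ Finset.range (s + n + 2) := by
      have := J.card_le_univ
      rw [Fintype.card_fin] at this
      rw [Finset.mem_range]
      omega
    have h2 : (DFinsupp.mk (β := fun e => degAt F base s e) (Finset.range (s + n + 2))
        fun e => piece e) (s + J.card) = piece (s + J.card) := DFinsupp.mk_of_mem h1
    erw [h2]
    exact (coord_ofFun (F := F) (f := fun a K => if s + K.card = s + J.card then coord a K x else 0)
      hJ).trans (if_pos rfl)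

theorem coord_empty_smul (a : PyramidAlgebra m d) {x : CubeModule F base} {a0 : A}
    (hx : coord a0 ∅ x = 0) : coord a0 ∅ (a • x) = 0 := by
  have hv : IsPyramidVertex n m (moveAll (base a0).1 ∅) := by
    rw [moveAll_empty]
    exact (base a0).2
  refine pyramidAlgebra_induction d F.c (P := fun a => coord a0 ∅ (a • x) = 0) ?_ ?_ ?_ ?_ ?_ a
  · rw [zero_smul, map_zero]
  · intro a b ha hb
    rw [add_smul, map_add, ha, hb, add_zero]
  · intro r a ha
    rw [smul_assoc, map_smul, ha, smul_zero]
  · intro j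
    rw [coord_boundIdem_smul, hx, ite_self]
  · intro t l a _
    rw [mul_smul, coord_gen_smul _ _ _ _ hv, if_neg]
    simp

/-- Arrows only produce basis elements with nonempty `J`. Conversely, each of those is an arrow
applied to one with a removable type taken out. -/
theorem mem_radPart_iff [Finite A] {x : CubeModule F base} :
    x ∈ radPart (stableRelations (m := m) d) (CubeModule F base) ↔ ∀ a, coord a ∅ x = 0 := by
  cases nonempty_fintype A
  constructor
  · intro hx a0
    induction hx using Submodule.span_induction with
    | mem y h =>
      obtain ⟨a, ha, x, rfl⟩ := h
      induction ha using Submodule.span_induction with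
      | mem a h =>
        obtain ⟨i, j, p, hp, rfl⟩ := h
        cases p with
        | nil => simp at hp
        | cons p a =>
          rw [toBound_cons, toBound_arrow d F.c, mul_smul, smul_assoc, map_smul,
            coord_gen_smul, if_neg (by simp), smul_zero]
          rw [moveAll_empty]
          exact (base a0).2
      | zero => rw [zero_smul, map_zero]
      | add a b _ _ ha hb => rw [add_smul, map_add, ha, hb, add_zero]
      | smul r a _ ha => rw [smul_assoc, map_smul, ha, smul_zero]
    | zero => exact map_zero _
    | add x y _ _ hx hy => rw [map_add, hx, hy, add_zero]
    | smul a x _ hx => exact coord_empty_smul a hx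
  · intro h
    rw [← sum_coord_smul_single x]
    refine Submodule.sum_mem _ fun a _ => Submodule.sum_mem _ fun J _ => ?_
    by_cases hJ : IsPyramidVertex n m (moveAll (base a).1 J)
    swap
    · rw [coord_of_not hJ, zero_smul]
      exact Submodule.zero_mem _
    rcases J.eq_empty_or_nonempty with rfl | hne
    · rw [h a, zero_smul]
      exact Submodule.zero_mem _
    · obtain ⟨t, ht, h'⟩ := exists_removable F.hn (le_trans (by norm_num) F.hm) (base a).2 hne hJ
      refine Submodule.smul_of_tower_mem _ _ (Submodule.subset_span
        ⟨_, gen_mem_degreePart (F := F) t (moveAll (base a).1 (J.erase t)),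
          single F base a (J.erase t), ?_⟩)
      rw [gen_smul_single a _ t (Finset.notMem_erase t J) h', Finset.insert_erase ht]

end CubeModule

end Translation

/-! ### The box complex and its contracting homotopy -/

section Resolution

variable {k : Type u} [Field k] {n m : ℕ}
  {d : Fin (n + 1) → Fin (n + 1) → (Fin n → ℤ) → k}

/-- The exponents of total degree `t` in which each token of `i` is moved at most once. -/
def InBox (i : PyramidVertex n m) (t : ℕ) (z : Fin (n + 1) → ℕ) : Prop :=
  ∑ s, z s = t ∧ ∀ s, (z s : ℤ) ≤ tokens n m i.1 s

/-- The labels of the indecomposable summands of the `t`-th term of the resolution. -/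
def Box (i : PyramidVertex n m) (t : ℕ) : Type := {z : Fin (n + 1) → ℕ // InBox i t z}

instance (i : PyramidVertex n m) (t : ℕ) : Finite (Box i t) := by
  refine Set.Finite.subset (Set.finite_Iic fun s => (tokens n m i.1 s).toNat) ?_
  rintro z ⟨-, h⟩ s
  have := h s
  change z s ≤ (tokens n m i.1 s).toNat
  omega

/-- The translate of `i` by a multiple displacement. -/
def shift (i : Fin n → ℤ) (z : Fin (n + 1) → ℕ) : Fin n → ℤ :=
  i + ∑ s, (z s : ℤ) • pyramidStep n s

theorem tokens_shift (hn : 1 ≤ n) (i : Fin n → ℤ) (z : Fin (n + 1) → ℕ) (u : Fin (n + 1)) :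
    tokens n m (shift i z) u = tokens n m i u + z (u - 1) - z u := by
  rw [shift, tokens_add, Pi.add_apply, tokenShift_sum_smul hn (fun s => (z s : ℤ))]
  ring

theorem shift_zero (i : Fin n → ℤ) : shift i 0 = i := by simp [shift]

theorem shift_add_single (i : Fin n → ℤ) (z : Fin (n + 1) → ℕ) (s : Fin (n + 1)) :
    shift i (z + Pi.single s 1) = shift i z + pyramidStep n s := by
  have : ∑ r, ((Pi.single s 1 : Fin (n + 1) → ℕ) r : ℤ) • pyramidStep n r = pyramidStep n s := by
    rw [Finset.sum_eq_single s]
    · simp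
    · intro r _ hr
      simp [hr]
    · simp
  simp only [shift, Pi.add_apply, Nat.cast_add, add_smul, Finset.sum_add_distrib, this]
  abel

/-- The endpoint depends only on the multidegree, so the differential compares coordinates at the
same vertex of the pyramid. -/
theorem moveAll_shift_add_single (i : Fin n → ℤ) (z : Fin (n + 1) → ℕ)
    {J : Finset (Fin (n + 1))} {s : Fin (n + 1)} (hs : s ∈ J) :
    moveAll (shift i (z + Pi.single s 1)) (J.erase s) = moveAll (shift i z) J := by
  rw [shift_add_single, ← moveAll_erase _ hs, moveAll, moveAll]
  abel

/-- Each place gives away at most the tokens it has in `i`, and incoming tokens only help. -/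
theorem InBox.shift_vertex (hn : 1 ≤ n) {i : PyramidVertex n m} {t : ℕ} {z : Fin (n + 1) → ℕ}
    (h : InBox i t z) : IsPyramidVertex n m (shift i.1 z) := by
  rw [isPyramidVertex_iff hn]
  intro u
  have := h.2 u
  rw [tokens_shift hn]
  omega

theorem sum_add_single (z : Fin (n + 1) → ℕ) (s : Fin (n + 1)) :
    ∑ r, (z + Pi.single s 1 : Fin (n + 1) → ℕ) r = ∑ r, z r + 1 := by
  simp [Finset.sum_add_distrib]

theorem InBox.of_add_single {i : PyramidVertex n m} {t : ℕ} {z : Fin (n + 1) → ℕ}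
    {s : Fin (n + 1)} (h : InBox i (t + 1) (z + Pi.single s 1)) : InBox i t z := by
  refine ⟨?_, fun r => le_trans ?_ (h.2 r)⟩
  · have := h.1
    rw [sum_add_single] at this
    omega
  · simp

theorem InBox.add_single {i : PyramidVertex n m} {t : ℕ} {z : Fin (n + 1) → ℕ}
    {s : Fin (n + 1)} (h : InBox i t z) (hs : (z s : ℤ) + 1 ≤ tokens n m i.1 s) :
    InBox i (t + 1) (z + Pi.single s 1) := by
  refine ⟨by rw [sum_add_single, h.1], fun r => ?_⟩
  by_cases hr : r = s
  · subst hr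
    simpa using hs
  · simpa [hr] using h.2 r

/-- The vertex that belongs to a label. -/
def boxBase (hn : 1 ≤ n) (i : PyramidVertex n m) (t : ℕ) (z : Box i t) : PyramidVertex n m :=
  ⟨shift i.1 z.1, z.2.shift_vertex hn⟩

/-- The sign of the component of the differential that removes `s` from `z + s`. -/
def boxSign (k : Type u) [Field k] (z : Fin (n + 1) → ℕ) (s : Fin (n + 1)) : k :=
  (-1) ^ ∑ r ∈ Finset.univ.filter (· < s), z r

theorem boxSign_mul_self (z : Fin (n + 1) → ℕ) (s : Fin (n + 1)) :
    boxSign k z s * boxSign k z s = 1 := by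
  rw [boxSign, ← pow_add, ← two_mul, pow_mul, neg_one_sq, one_pow]

theorem boxSign_add_single (z : Fin (n + 1) → ℕ) (s r : Fin (n + 1)) :
    boxSign k (z + Pi.single s 1) r = if s < r then - boxSign k z r else boxSign k z r := by
  have : ∑ x ∈ Finset.univ.filter (· < r), (Pi.single s 1 : Fin (n + 1) → ℕ) x
      = if s < r then 1 else 0 := by
    rw [Finset.sum_pi_single']
    simp
  simp only [boxSign, Pi.add_apply, Finset.sum_add_distrib, this, pow_add]
  split_ifs <;> simp

theorem boxSign_anticomm (z : Fin (n + 1) → ℕ) {s r : Fin (n + 1)} (h : s ≠ r) :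
    boxSign k z s * boxSign k (z + Pi.single s 1) r
      = -(boxSign k z r * boxSign k (z + Pi.single r 1) s) := by
  rw [boxSign_add_single, boxSign_add_single]
  rcases lt_or_gt_of_ne h with h | h
  · rw [if_pos h, if_neg h.not_gt]; ring
  · rw [if_neg (not_lt_of_gt h), if_pos h]; ring

/-- The sign rule that makes the homotopy in direction `r` anticommute with the part of the
differential in direction `s`. -/
theorem boxSign_cross (z : Fin (n + 1) → ℕ) {s r : Fin (n + 1)} (h : s ≠ r) :
    boxSign k (z + Pi.single r 1) s * boxSign k (z + Pi.single s 1) r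
      = -(boxSign k z s * boxSign k z r) := by
  rw [boxSign_add_single, boxSign_add_single]
  rcases lt_or_gt_of_ne h with h | h
  · rw [if_pos h, if_neg h.not_gt]; ring
  · rw [if_neg (not_lt_of_gt h), if_pos h]; ring

theorem sum_sum_erase_eq_zero {T : Type*} [DecidableEq T] (J : Finset T) (G : T → T → k)
    (h : ∀ s r, s ≠ r → G s r = - G r s) : ∑ s ∈ J, ∑ r ∈ J.erase s, G s r = 0 := by
  rw [Finset.sum_sigma']
  refine Finset.sum_involution (fun p _ => ⟨p.2, p.1⟩) ?_ ?_ ?_ ?_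
  · rintro ⟨s, r⟩ hp
    simp only [Finset.mem_sigma, Finset.mem_erase] at hp
    rw [h s r hp.2.1.symm, neg_add_cancel]
  · rintro ⟨s, r⟩ hp _ he
    simp only [Finset.mem_sigma, Finset.mem_erase] at hp
    exact hp.2.1 (congrArg Sigma.fst he)
  · rintro ⟨s, r⟩ hp
    simp only [Finset.mem_sigma, Finset.mem_erase] at hp ⊢
    exact ⟨hp.2.2, hp.2.1.symm, hp.1⟩
  · rintro ⟨s, r⟩ _
    rfl

/-- The `t`-th term of the resolution. -/
abbrev BoxModule (F : PyramidFrame (m := m) d) (i : PyramidVertex n m) (t : ℕ) : Type u :=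
  CubeModule F (boxBase F.hn i t)

namespace BoxModule

open CubeModule

variable {F : PyramidFrame (m := m) d} {i : PyramidVertex n m} {t : ℕ}

open scoped Classical in
/-- The coordinates, extended by zero to all exponents. -/
def bcoord (z : Fin (n + 1) → ℕ) (J : Finset (Fin (n + 1))) : BoxModule F i t →ₗ[k] k :=
  if h : InBox i t z then coord (base := boxBase F.hn i t) ⟨z, h⟩ J else 0

theorem bcoord_of_not {z : Fin (n + 1) → ℕ} (h : ¬ InBox i t z) (J : Finset (Fin (n + 1)))
    (x : BoxModule F i t) : bcoord z J x = 0 := by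
  rw [bcoord, dif_neg h, LinearMap.zero_apply]

theorem bcoord_of_inBox {z : Fin (n + 1) → ℕ} (h : InBox i t z) (J : Finset (Fin (n + 1)))
    (x : BoxModule F i t) : bcoord z J x = coord (base := boxBase F.hn i t) ⟨z, h⟩ J x := by
  rw [bcoord, dif_pos h]

theorem bcoord_val (z : Box i t) (J : Finset (Fin (n + 1))) (x : BoxModule F i t) :
    bcoord z.1 J x = coord z J x := bcoord_of_inBox z.2 J x

theorem bcoord_of_not_vertex {z : Fin (n + 1) → ℕ} {J : Finset (Fin (n + 1))}
    (h : ¬ IsPyramidVertex n m (moveAll (shift i.1 z) J)) (x : BoxModule F i t) :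
    bcoord z J x = 0 := by
  by_cases h' : InBox i t z
  · rw [bcoord_of_inBox h']
    exact coord_of_not h x
  · exact bcoord_of_not h' _ _

theorem ext_bcoord {x y : BoxModule F i t}
    (h : ∀ z J, InBox i t z → IsPyramidVertex n m (moveAll (shift i.1 z) J) →
      bcoord z J x = bcoord z J y) : x = y := by
  refine ext fun z J hJ => ?_
  have := h z.1 J z.2 hJ
  rwa [bcoord_of_inBox z.2, bcoord_of_inBox z.2] at this

open scoped Classical in
theorem bcoord_boundIdem_smul (j : PyramidVertex n m) (z : Fin (n + 1) → ℕ)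
    (J : Finset (Fin (n + 1))) (x : BoxModule F i t) :
    bcoord z J (boundIdem (stableRelations d) j • x)
      = if moveAll (shift i.1 z) J = j.1 then bcoord z J x else 0 := by
  by_cases h : InBox i t z
  · simp only [bcoord_of_inBox h]
    exact coord_boundIdem_smul _ _ _ _
  · simp only [bcoord_of_not h, ite_self]

open scoped Classical in
theorem bcoord_gen_smul (s : Fin (n + 1)) (l : Fin n → ℤ) (z : Fin (n + 1) → ℕ)
    (J : Finset (Fin (n + 1))) (hJ : IsPyramidVertex n m (moveAll (shift i.1 z) J))
    (x : BoxModule F i t) :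
    bcoord z J (F.g s l • x)
      = if s ∈ J ∧ moveAll (shift i.1 z) (J.erase s) = l then bcoord z (J.erase s) x else 0 := by
  by_cases h : InBox i t z
  · have hJ' : IsPyramidVertex n m (moveAll (boxBase F.hn i t ⟨z, h⟩).1 J) := hJ
    rw [bcoord_of_inBox h, bcoord_of_inBox h]
    exact coord_gen_smul s l (⟨z, h⟩ : Box i t) J hJ' x
  · simp only [bcoord_of_not h, ite_self]

/-- The element with given coordinates. -/
def ofBoxFun (F : PyramidFrame (m := m) d) (i : PyramidVertex n m) (t : ℕ)
    (f : (Fin (n + 1) → ℕ) → Finset (Fin (n + 1)) → k) : BoxModule F i t :=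
  ofFun F (boxBase F.hn i t) fun z J => f z.1 J

theorem bcoord_ofBoxFun {f : (Fin (n + 1) → ℕ) → Finset (Fin (n + 1)) → k} {z : Fin (n + 1) → ℕ}
    (h : InBox i t z) {J : Finset (Fin (n + 1))}
    (hJ : IsPyramidVertex n m (moveAll (shift i.1 z) J)) :
    bcoord z J (ofBoxFun F i t f) = f z J := by
  rw [bcoord_of_inBox h]
  exact coord_ofFun (F := F) (base := boxBase F.hn i t) (f := fun z J => f z.1 J)
    (a := (⟨z, h⟩ : Box i t)) hJ

/-- The coordinates of the differential. -/
def diffCoord (x : BoxModule F i t) (z : Fin (n + 1) → ℕ) (J : Finset (Fin (n + 1))) : k :=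
  ∑ s ∈ J, boxSign k z s * bcoord (z + Pi.single s 1) (J.erase s) x

/-- The differential as a `k`-linear map. -/
def diffAux (F : PyramidFrame (m := m) d) (i : PyramidVertex n m) (t : ℕ) :
    BoxModule F i (t + 1) →ₗ[k] BoxModule F i t where
  toFun x := ofBoxFun F i t (diffCoord x)
  map_add' x y := ext_bcoord fun z J hz hJ => by
    rw [map_add]
    simp only [bcoord_ofBoxFun hz hJ, diffCoord, map_add, mul_add, Finset.sum_add_distrib]
  map_smul' r x := ext_bcoord fun z J hz hJ => by
    rw [map_smul]
    simp only [bcoord_ofBoxFun hz hJ, diffCoord, map_smul, RingHom.id_apply, smul_eq_mul,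
      Finset.mul_sum]
    exact Finset.sum_congr rfl fun s _ => by ring

theorem diffCoord_of_not_vertex {z : Fin (n + 1) → ℕ} {J : Finset (Fin (n + 1))}
    (h : ¬ IsPyramidVertex n m (moveAll (shift i.1 z) J)) (x : BoxModule F i t) :
    diffCoord x z J = 0 :=
  Finset.sum_eq_zero fun s hs => by
    rw [bcoord_of_not_vertex, mul_zero]
    rwa [moveAll_shift_add_single _ _ hs]

/-- Boxes are closed under lowering an exponent. Hence the coordinate formula for the differential
holds for all `z`, without side conditions. -/
theorem diffCoord_of_not {z : Fin (n + 1) → ℕ} (h : ¬ InBox i t z) (J : Finset (Fin (n + 1)))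
    (x : BoxModule F i (t + 1)) : diffCoord x z J = 0 :=
  Finset.sum_eq_zero fun s hs => by
    have h' : ¬ InBox i (t + 1) (z + Pi.single s 1) := fun h' => h h'.of_add_single
    rw [bcoord_of_not h', mul_zero]

theorem bcoord_diffAux (x : BoxModule F i (t + 1)) (z : Fin (n + 1) → ℕ)
    (J : Finset (Fin (n + 1))) : bcoord z J (diffAux F i t x) = diffCoord x z J := by
  by_cases hz : InBox i t z
  · by_cases hJ : IsPyramidVertex n m (moveAll (shift i.1 z) J)
    · exact bcoord_ofBoxFun (F := F) (f := diffCoord x) hz hJ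
    · rw [bcoord_of_not_vertex hJ, diffCoord_of_not_vertex hJ]
  · rw [bcoord_of_not hz, diffCoord_of_not hz]

/-- The differential of the resolution. -/
def diff (F : PyramidFrame (m := m) d) (i : PyramidVertex n m) (t : ℕ) :
    BoxModule F i (t + 1) →ₗ[PyramidAlgebra m d] BoxModule F i t :=
  F.toLinear (diffAux F i t)
    (by
      intro j x
      refine ext_bcoord fun z J hz hJ => ?_
      rw [bcoord_diffAux, bcoord_boundIdem_smul, bcoord_diffAux, diffCoord, diffCoord]
      split_ifs with h
      · refine Finset.sum_congr rfl fun s hs => ?_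
        rw [bcoord_boundIdem_smul, moveAll_shift_add_single _ _ hs]
        congr 1
        exact if_pos h
      · refine Finset.sum_eq_zero fun s hs => ?_
        rw [bcoord_boundIdem_smul, moveAll_shift_add_single _ _ hs]
        exact mul_eq_zero_of_right _ (if_neg h))
    (by
      intro r l x
      refine ext_bcoord fun z J hz hJ => ?_
      rw [bcoord_diffAux, bcoord_gen_smul _ _ _ _ hJ, bcoord_diffAux, diffCoord, diffCoord]
      have e : ∀ s ∈ J, bcoord (z + Pi.single s 1) (J.erase s) (F.g r l • x)
          = open scoped Classical in if r ∈ J.erase s ∧ moveAll (shift i.1 z) (J.erase r) = l then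
            bcoord (z + Pi.single s 1) ((J.erase r).erase s) x else 0 := by
        intro s hs
        rw [bcoord_gen_smul _ _ _ _ (by rwa [moveAll_shift_add_single _ _ hs]),
          Finset.erase_right_comm]
        by_cases h : r ∈ J.erase s
        · have hs' : s ∈ J.erase r := by
            rw [Finset.mem_erase] at h ⊢
            exact ⟨h.1.symm, hs⟩
          rw [moveAll_shift_add_single _ _ hs']
        · simp [h]
      split_ifs with h
      · rw [← Finset.add_sum_erase J _ h.1, e r h.1, if_neg (by simp), mul_zero, zero_add]
        refine Finset.sum_congr rfl fun s hs => ?_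
        rw [e s (Finset.mem_of_mem_erase hs), if_pos]
        rw [Finset.mem_erase] at hs ⊢
        exact ⟨⟨hs.1.symm, h.1⟩, h.2⟩
      · refine Finset.sum_eq_zero fun s hs => ?_
        rw [e s hs, if_neg, mul_zero]
        rintro ⟨h1, h2⟩
        exact h ⟨Finset.mem_of_mem_erase h1, h2⟩)

theorem bcoord_diff (x : BoxModule F i (t + 1)) (z : Fin (n + 1) → ℕ)
    (J : Finset (Fin (n + 1))) : bcoord z J (diff F i t x) = diffCoord x z J :=
  bcoord_diffAux x z J

/-- Two units can be moved in either order, with opposite signs, so the terms cancel in pairs. -/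
theorem diffCoord_diff (x : BoxModule F i (t + 1)) (z : Fin (n + 1) → ℕ)
    (J : Finset (Fin (n + 1))) : diffCoord (diff F i t x) z J = 0 := by
  rw [diffCoord]
  simp only [bcoord_diff, diffCoord, Finset.mul_sum]
  refine sum_sum_erase_eq_zero J (fun s r => boxSign k z s * (boxSign k (z + Pi.single s 1) r *
    bcoord (z + Pi.single s 1 + Pi.single r 1) ((J.erase s).erase r) x)) fun s r hsr => ?_
  rw [← mul_assoc, boxSign_anticomm z hsr, Finset.erase_right_comm, add_right_comm z]
  ring

theorem diff_diff (x : BoxModule F i (t + 1 + 1)) : diff F i t (diff F i (t + 1) x) = 0 :=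
  ext_bcoord fun z J _ _ => by rw [bcoord_diff, diffCoord_diff, map_zero]

/-- The place `s` at which a multidegree `w` can be split in two ways. -/
def IsFree (i : PyramidVertex n m) (w : Fin (n + 1) → ℕ) (s : Fin (n + 1)) : Prop :=
  1 ≤ w s ∧ (w s : ℤ) ≤ tokens n m i.1 s

/-- The multidegree of a basis element. -/
def weight (z : Fin (n + 1) → ℕ) (J : Finset (Fin (n + 1))) : Fin (n + 1) → ℕ := fun s =>
  z s + if s ∈ J then 1 else 0

theorem weight_add_single (z : Fin (n + 1) → ℕ) {J : Finset (Fin (n + 1))} {s : Fin (n + 1)}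
    (hs : s ∈ J) : weight (z + Pi.single s 1) (J.erase s) = weight z J := by
  ext r
  by_cases h : r = s
  · subst h
    simp [weight, hs]
  · simp [weight, h]

open scoped Classical in
/-- The contracting homotopy. -/
def homotopy (x : BoxModule F i t) : BoxModule F i (t + 1) :=
  ofBoxFun F i (t + 1) fun z K =>
    if h : ∃ s, IsFree i (weight z K) s then
      if h.choose ∈ K then 0 else boxSign k (z - Pi.single h.choose 1) h.choose *
        bcoord (z - Pi.single h.choose 1) (insert h.choose K) x
    else 0

/-- The free place is chosen from the multidegree alone, which the differential preserves. The same
choice thus serves every term of the differential of the homotopy. -/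
theorem bcoord_homotopy (x : BoxModule F i t) {z : Fin (n + 1) → ℕ} (hz : InBox i t z)
    {J : Finset (Fin (n + 1))} (hJ : IsPyramidVertex n m (moveAll (shift i.1 z) J))
    (h : ∃ s, IsFree i (weight z J) s) {s : Fin (n + 1)} (hs : s ∈ J) :
    bcoord (z + Pi.single s 1) (J.erase s) (homotopy x) =
      if h.choose ∈ J.erase s then 0 else
        boxSign k (z + Pi.single s 1 - Pi.single h.choose 1) h.choose *
        bcoord (z + Pi.single s 1 - Pi.single h.choose 1) (insert h.choose (J.erase s)) x := by
  classical
  by_cases hz' : InBox i (t + 1) (z + Pi.single s 1)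
  · rw [homotopy, bcoord_ofBoxFun hz' (by rwa [moveAll_shift_add_single _ _ hs])]
    simp only [weight_add_single z hs]
    rw [dif_pos h]
  -- Outside the box the left side is zero by convention. The right side vanishes too: `s` is not
  -- the free place, and the exponent at `s` remains too large.
  · rw [bcoord_of_not hz']
    split_ifs with h1
    · rfl
    · have hf := h.choose_spec
      by_cases hc : h.choose = s
      · rw [hc] at hf
        refine absurd (hz.add_single ?_) hz'
        have := hf.2
        simp only [weight, if_pos hs] at this
        exact_mod_cast this
      · rw [bcoord_of_not, mul_zero]
        intro hb
        refine hz' (hz.add_single ?_)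
        have := hb.2 s
        simpa [Ne.symm hc] using this

/-- If the free place `r` lies in `J`, only the term that takes `r` out of `J` survives, and it
returns the coordinate of `x`. Otherwise the sum is rewritten by the cycle condition one step lower
in direction `r`. -/
theorem eq_diff_homotopy {x : BoxModule F i t} (hx : ∀ z J, diffCoord x z J = 0)
    {z : Fin (n + 1) → ℕ} (hz : InBox i t z) {J : Finset (Fin (n + 1))}
    (hJ : IsPyramidVertex n m (moveAll (shift i.1 z) J))
    (h : ∃ s, IsFree i (weight z J) s) :
    bcoord z J x = diffCoord (homotopy x) z J := by
  have hf := h.choose_spec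
  have e := fun s (hs : s ∈ J) => bcoord_homotopy x hz hJ h hs
  generalize h.choose = r at hf e
  rw [diffCoord]
  by_cases hr : r ∈ J
  · rw [Finset.sum_eq_single_of_mem r hr]
    · rw [e r hr, if_neg (Finset.notMem_erase r J), add_tsub_cancel_right, Finset.insert_erase hr,
        ← mul_assoc, boxSign_mul_self, one_mul]
    · intro s hs hsr
      rw [e s hs, if_pos (Finset.mem_erase.2 ⟨hsr.symm, hr⟩), mul_zero]
  · have hzr : 1 ≤ z r := by
      have := hf.1
      simpa [weight, hr] using this
    obtain ⟨y, rfl⟩ : ∃ y, z = y + Pi.single r 1 := by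
      refine ⟨z - Pi.single r 1, (tsub_add_cancel_of_le ?_).symm⟩
      intro u
      by_cases hu : u = r
      · subst hu
        simpa using hzr
      · simp [hu]
    -- With `z = y + r`, the term for `r` in this equation is the wanted coordinate, and the others
    -- are the terms of the homotopy.
    have h1 := hx y (insert r J)
    rw [diffCoord, Finset.sum_insert hr, Finset.erase_insert hr] at h1
    have h2 : ∑ s ∈ J, boxSign k (y + Pi.single r 1) s *
        bcoord (y + Pi.single r 1 + Pi.single s 1) (J.erase s) (homotopy x)
        = - (boxSign k y r * ∑ s ∈ J, boxSign k y s *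
          bcoord (y + Pi.single s 1) ((insert r J).erase s) x) := by
      rw [Finset.mul_sum, ← Finset.sum_neg_distrib]
      refine Finset.sum_congr rfl fun s hs => ?_
      have hsr : s ≠ r := fun h => hr (h ▸ hs)
      rw [e s hs, if_neg fun h => hr (Finset.mem_of_mem_erase h), add_right_comm,
        add_tsub_cancel_right, Finset.erase_insert_of_ne hsr.symm, ← mul_assoc,
        boxSign_cross y hsr]
      ring
    rw [h2]
    have h3 := boxSign_mul_self (k := k) y r
    linear_combination (-(bcoord (y + Pi.single r 1) J x)) * h3 + boxSign k y r * h1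

/-- Without a free place, each place is untouched or fully used up. The cycle forces a uniform
choice, and if all places are used up, `t` is the total number `m - 1` of tokens. -/
theorem eq_or_eq_of_not_isFree (hn : 1 ≤ n) {z : Fin (n + 1) → ℕ} (hz : InBox i t z)
    {J : Finset (Fin (n + 1))} (hJ : IsPyramidVertex n m (moveAll (shift i.1 z) J))
    (h : ¬ ∃ s, IsFree i (weight z J) s) :
    (t = 0 ∧ J = ∅) ∨ ((t : ℤ) = m - 1 ∧ J = Finset.univ) := by
  push Not at h
  have key : ∀ s, (z s = 0 ∧ s ∉ J) ∨ ((z s : ℤ) = tokens n m i.1 s ∧ s ∈ J) := by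
    intro s
    have h1 := h s
    have h2 := hz.2 s
    simp only [IsFree, weight] at h1
    by_cases hs : s ∈ J
    · rw [if_pos hs] at h1
      right
      refine ⟨?_, hs⟩
      by_contra h3
      exact h1 ⟨by omega, by push_cast; omega⟩
    · rw [if_neg hs] at h1
      left
      refine ⟨?_, hs⟩
      by_contra h3
      exact h1 ⟨by omega, by push_cast; omega⟩
  -- If place `s` is untouched and `s + 1` is used up, then `s + 1` receives nothing and gives away
  -- one token more than it has, leaving `-1`.
  have hcl : ∀ s, s ∉ J → s + 1 ∉ J := by
    intro s hs hs'
    have h1 := (isPyramidVertex_iff hn _).1 hJ (s + 1)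
    rw [tokens_moveAll hn, tokens_shift hn, add_sub_cancel_right, if_neg hs, if_pos hs'] at h1
    have h2 := ((key s).resolve_right fun h => hs h.2).1
    have h3 := ((key (s + 1)).resolve_left fun h => h.2 hs').1
    omega
  by_cases hJe : J = Finset.univ
  · right
    refine ⟨?_, hJe⟩
    rw [← hz.1, ← sum_tokens (m := m) i.1]
    push_cast
    refine Finset.sum_congr rfl fun s _ => ?_
    exact ((key s).resolve_left fun h => h.2 (hJe ▸ Finset.mem_univ s)).1
  · left
    have hc : Jᶜ = Finset.univ := by
      refine eq_univ_of_add_one_mem ?_ fun v hv => ?_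
      · rw [Finset.nonempty_iff_ne_empty]
        exact fun h => hJe (Finset.compl_eq_empty_iff J |>.1 h)
      · rw [Finset.mem_compl] at hv ⊢
        exact hcl v hv
    have hJ0 : J = ∅ := by
      rw [← compl_compl J, hc, Finset.compl_univ]
    refine ⟨?_, hJ0⟩
    rw [← hz.1]
    refine Finset.sum_eq_zero fun s _ => ?_
    exact ((key s).resolve_right fun h => by simp [hJ0] at h).1

/-- Since `z` has positive degree, some `z s` is positive. The coordinate at `(z, ∅)` then appears,
up to sign, as the only term of the differential at `z` lowered in `s` and the set `{s}`. -/
theorem mem_radPart_of_diff_eq_zero {x : BoxModule F i (t + 1)} (hx : diff F i t x = 0) :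
    x ∈ radPart (stableRelations (m := m) d) (BoxModule F i (t + 1)) := by
  rw [mem_radPart_iff]
  intro z
  obtain ⟨s, hs⟩ : ∃ s, 1 ≤ z.1 s := by
    by_contra! h
    have := z.2.1
    rw [Finset.sum_eq_zero fun s _ => by have := h s; omega] at this
    omega
  obtain ⟨y, hy⟩ : ∃ y, z.1 = y + Pi.single s 1 := by
    refine ⟨z.1 - Pi.single s 1, (tsub_add_cancel_of_le ?_).symm⟩
    intro u
    by_cases hu : u = s
    · subst hu
      simpa using hs
    · simp [hu]
  have h1 := bcoord_diff x y {s}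
  rw [hx, map_zero, diffCoord, Finset.sum_singleton, ← hy, Finset.erase_singleton,
    bcoord_of_inBox z.2] at h1
  have h2 := boxSign_mul_self (k := k) y s
  have h3 : boxSign k y s ≠ 0 := fun h => by simp [h] at h2
  exact (mul_eq_zero.1 h1.symm).resolve_left h3

end BoxModule

end Resolution

/-! ### The augmented resolution and almost Koszulity -/

section Koszul

variable {k : Type u} [Field k] {n m : ℕ}
  {d : Fin (n + 1) → Fin (n + 1) → (Fin n → ℤ) → k}

theorem map_mem_radPart {V : Type v} [Quiver.{w} V] [Fintype V] (ρ : Set (PathAlgebra k V))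
    {M N : Type*} [AddCommGroup M] [AddCommGroup N] [Module (BoundAlgebra ρ) M]
    [Module (BoundAlgebra ρ) N] (φ : M →ₗ[BoundAlgebra ρ] N) {x : M} (hx : x ∈ radPart ρ M) :
    φ x ∈ radPart ρ N := by
  induction hx using Submodule.span_induction with
  | mem y h =>
    obtain ⟨a, ha, x, rfl⟩ := h
    rw [map_smul]
    exact Submodule.subset_span ⟨a, ha, φ x, rfl⟩
  | zero => rw [map_zero]; exact Submodule.zero_mem _
  | add x y _ _ hx hy => rw [map_add]; exact Submodule.add_mem _ hx hy
  | smul a x _ hx => rw [map_smul]; exact Submodule.smul_mem _ _ hx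

namespace BoxModule

open CubeModule

variable {F : PyramidFrame (m := m) d} {i : PyramidVertex n m}

/-- The only label in degree `0`. -/
def boxZero (F : PyramidFrame (m := m) d) (i : PyramidVertex n m) : Box i 0 :=
  ⟨0, by simp, fun s => (isPyramidVertex_iff F.hn i.1).1 i.2 s⟩

theorem eq_boxZero (z : Box i 0) : z = boxZero F i := by
  refine Subtype.ext (funext fun s => ?_)
  have := z.2.1
  rw [Finset.sum_eq_zero_iff] at this
  exact this s (Finset.mem_univ s)

theorem boxBase_boxZero : boxBase F.hn i 0 (boxZero F i) = i :=
  Subtype.ext (shift_zero i.1)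

theorem _root_.PyramidFrame.b_mem_projAt (F : PyramidFrame (m := m) d) (i : PyramidVertex n m)
    (J : Finset (Fin (n + 1))) (hJ : IsPyramidVertex n m (moveAll i.1 J)) :
    F.b i J ∈ projAt (stableRelations d) i := by
  refine F.set_induction (P := fun J => F.b i J ∈ projAt (stableRelations d) i) ?_ ?_ J hJ
  · rw [F.b_empty]
    exact Submodule.mem_span_singleton_self _
  · intro J t ht h1 h2 ih
    rw [← F.gen_mul_b i J t ht h1 h2]
    exact Submodule.smul_mem _ _ ih

theorem toAlgebra_boxZero_mem (x : BoxModule F i 0) :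
    toAlgebra F (boxBase F.hn i 0) (boxZero F i) x ∈ projAt (stableRelations d) i := by
  rw [toAlgebra_apply]
  refine Submodule.sum_mem _ fun J _ => ?_
  by_cases hJ : IsPyramidVertex n m (moveAll (boxBase F.hn i 0 (boxZero F i)).1 J)
  · have h := F.b_mem_projAt _ J hJ
    rw [boxBase_boxZero] at h
    rw [boxBase_boxZero]
    exact Submodule.smul_of_tower_mem _ _ h
  · rw [coord_of_not hJ, zero_smul]
    exact Submodule.zero_mem _

/-- The projection to `Λ e_i`. -/
def toProj (F : PyramidFrame (m := m) d) (i : PyramidVertex n m) :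
    BoxModule F i 0 →ₗ[PyramidAlgebra m d] projAt (stableRelations (m := m) d) i :=
  (toAlgebra F (boxBase F.hn i 0) (boxZero F i)).codRestrict _ toAlgebra_boxZero_mem

/-- The map from `Λ e_i`. -/
def ofProj (F : PyramidFrame (m := m) d) (i : PyramidVertex n m) :
    projAt (stableRelations (m := m) d) i →ₗ[PyramidAlgebra m d] BoxModule F i 0 :=
  (LinearMap.toSpanSingleton (PyramidAlgebra m d) _
    (single F (boxBase F.hn i 0) (boxZero F i) ∅)).comp (Submodule.subtype _)

theorem ofProj_toProj (x : BoxModule F i 0) : ofProj F i (toProj F i x) = x := by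
  cases nonempty_fintype (Box i 0)
  have h := toAlgebra_smul_single x
  rw [Fintype.sum_eq_single (boxZero F i) fun z hz => absurd (eq_boxZero z) hz] at h
  exact h

/-- The augmentation. -/
def augmentation (F : PyramidFrame (m := m) d) (i : PyramidVertex n m) :
    BoxModule F i 0 →ₗ[PyramidAlgebra m d] simpleAt (stableRelations (m := m) d) i :=
  (Submodule.mkQ _).comp (toProj F i)

/-- Module maps preserve the radical, so both directions follow from `toProj` and its left inverse
`ofProj`. -/
theorem augmentation_eq_zero_iff (x : BoxModule F i 0) :
    augmentation F i x = 0 ↔ x ∈ radPart (stableRelations (m := m) d) (BoxModule F i 0) := by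
  rw [augmentation, LinearMap.comp_apply, Submodule.mkQ_apply, Submodule.Quotient.mk_eq_zero]
  constructor
  · intro h
    rw [← ofProj_toProj x]
    exact map_mem_radPart _ _ h
  · exact map_mem_radPart _ _

theorem toProj_single :
    (toProj F i (single F (boxBase F.hn i 0) (boxZero F i) ∅) : PyramidAlgebra m d)
      = boundIdem (stableRelations d) i := by
  change toAlgebra F (boxBase F.hn i 0) (boxZero F i) _ = _
  rw [toAlgebra_apply, Finset.sum_eq_single ∅]
  · rw [coord_single, if_pos ⟨rfl, rfl⟩, one_smul, F.b_empty, boxBase_boxZero]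
    rw [moveAll_empty]
    exact (boxBase F.hn i 0 (boxZero F i)).2
  · intro J _ hJ
    by_cases h : IsPyramidVertex n m (moveAll (boxBase F.hn i 0 (boxZero F i)).1 J)
    · rw [coord_single _ _ _ _ h, if_neg fun h' => hJ h'.2, zero_smul]
    · rw [coord_of_not h, zero_smul]
  · simp

theorem augmentation_surjective : Function.Surjective (augmentation F i) := by
  intro y
  obtain ⟨⟨y, hy⟩, rfl⟩ := Submodule.mkQ_surjective _ y
  obtain ⟨a, rfl⟩ := Submodule.mem_span_singleton.1 hy
  refine ⟨a • single F (boxBase F.hn i 0) (boxZero F i) ∅, ?_⟩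
  rw [augmentation, LinearMap.comp_apply]
  congr 1
  refine Subtype.ext ?_
  rw [map_smul, Submodule.coe_smul, toProj_single]

/-- The Koszul type resolution of the simple module at `i`. -/
def resolution (F : PyramidFrame (m := m) d) (i : PyramidVertex n m) :
    ResolutionData (stableRelations (m := m) d) i where
  P t := BoxModule F i t
  deg t e := degAt F (boxBase F.hn i t) t e
  ε := augmentation F i
  f t := diff F i t

theorem kernel_le_radPart (t : ℕ) :
    (resolution F i).kernel t ≤ radPart (stableRelations (m := m) d) (BoxModule F i t) := by
  cases t with
  | zero => exact fun x hx => (augmentation_eq_zero_iff x).1 hx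
  | succ t => exact fun x hx => mem_radPart_of_diff_eq_zero hx

theorem diffCoord_of_mem_kernel {t : ℕ} {x : BoxModule F i t} (hx : x ∈ (resolution F i).kernel t)
    (z : Fin (n + 1) → ℕ) (J : Finset (Fin (n + 1))) : diffCoord x z J = 0 := by
  cases t with
  | zero =>
    -- In step `0` the condition is vacuous: no exponent of the form `z + s` has total degree `0`.
    refine Finset.sum_eq_zero fun s _ => ?_
    rw [bcoord_of_not, mul_zero]
    intro h
    have := h.1
    rw [sum_add_single] at this
    omega
  | succ t =>
    have h : diff F i t x = 0 := hx
    rw [← bcoord_diff, h, map_zero]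

/-- The homotopy supplies a preimage at multidegrees with a free place. Of the two exceptional ones,
the one with `J = ∅` vanishes on the kernel by minimality, and the other needs `t = m - 1`. -/
theorem range_diff {t : ℕ} (ht : t + 1 < m) :
    LinearMap.range (diff F i t) = (resolution F i).kernel t := by
  refine le_antisymm ?_ fun x hx => ?_
  · rintro _ ⟨x, rfl⟩
    cases t with
    | zero =>
      refine (augmentation_eq_zero_iff _).2 (mem_radPart_iff.2 fun z => ?_)
      rw [← bcoord_val, bcoord_diff, diffCoord, Finset.sum_empty]
    | succ t => exact diff_diff x
  · refine ⟨homotopy x, (ext_bcoord fun z J hz hJ => ?_).symm⟩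
    rw [bcoord_diff]
    by_cases h : ∃ s, IsFree i (weight z J) s
    · exact eq_diff_homotopy (diffCoord_of_mem_kernel hx) hz hJ h
    · rcases eq_or_eq_of_not_isFree F.hn hz hJ h with ⟨-, rfl⟩ | ⟨h1, -⟩
      · rw [diffCoord, Finset.sum_empty, bcoord_of_inBox hz]
        exact mem_radPart_iff.1 (kernel_le_radPart t hx) ⟨z, hz⟩
      · omega

/-- The homotopy now lands in step `m`, whose box is empty because there are only `m - 1` tokens.
Coordinates with a free place therefore vanish, and only those with `J` full remain. -/
theorem kernel_last {t : ℕ} (ht : t + 1 = m) {x : BoxModule F i t}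
    (hx : x ∈ (resolution F i).kernel t) :
    x ∈ degAt F (boxBase F.hn i t) t (n + 1 + t) := by
  intro z J hne
  have hJ : IsPyramidVertex n m (moveAll (shift i.1 z.1) J) := by
    by_contra h
    exact hne (coord_of_not h x)
  rw [← bcoord_val] at hne
  by_cases h : ∃ s, IsFree i (weight z.1 J) s
  · refine absurd ?_ hne
    rw [eq_diff_homotopy (diffCoord_of_mem_kernel hx) z.2 hJ h]
    refine Finset.sum_eq_zero fun s _ => ?_
    rw [bcoord_of_not, mul_zero]
    intro hb
    have h1 := sum_tokens (m := m) i.1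
    have h2 := Finset.sum_le_sum fun s (_ : s ∈ Finset.univ) => hb.2 s
    rw [h1, ← Nat.cast_sum, hb.1] at h2
    push_cast at h2
    omega
  · rcases eq_or_eq_of_not_isFree F.hn z.2 hJ h with ⟨h1, -⟩ | ⟨-, rfl⟩
    · have := F.hm
      omega
    · rw [Finset.card_univ, Fintype.card_fin, add_comm]

/-- Moving a unit from `z` into `J` lowers the step by one and raises the cardinality of `J` by one.
-/
theorem diff_mem_degAt {t e : ℕ} {x : BoxModule F i (t + 1)}
    (hx : x ∈ degAt F (boxBase F.hn i (t + 1)) (t + 1) e) :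
    diff F i t x ∈ degAt F (boxBase F.hn i t) t e := by
  intro z J hne
  rw [← bcoord_val, bcoord_diff] at hne
  obtain ⟨s, hs, h2⟩ := Finset.exists_ne_zero_of_sum_ne_zero hne
  have h3 := right_ne_zero_of_mul h2
  have hb : InBox i (t + 1) (z.1 + Pi.single s 1) := by
    by_contra h
    exact h3 (bcoord_of_not h _ _)
  rw [bcoord_of_inBox hb] at h3
  have h4 := hx _ _ h3
  have h5 := Finset.card_erase_add_one hs
  omega

theorem isMinimalResolution {q : ℕ} (hq : q + 1 = m) :
    (resolution F i).IsMinimalResolution q where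
  projective t _ := inferInstanceAs (Module.Projective (PyramidAlgebra m d) (BoxModule F i t))
  graded t _ := isInternal_degAt t
  graded_smul t _ c e a ha x hx := smul_mem_degAt ha hx
  graded_aug e he x hx := by
    refine (augmentation_eq_zero_iff x).2 (mem_radPart_iff.2 fun z => ?_)
    by_contra h
    have := hx z ∅ h
    rw [Finset.card_empty] at this
    exact he this.symm
  graded_map t _ e x hx := diff_mem_degAt hx
  surjective := augmentation_surjective
  exact t ht := by
    have : t + 1 ≤ q := by exact_mod_cast ht
    exact range_diff (by omega)
  minimal t _ := kernel_le_radPart t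

theorem span_deg (t : ℕ) :
    Submodule.span (PyramidAlgebra m d) (degAt F (boxBase F.hn i t) t t : Set (BoxModule F i t))
      = ⊤ := by
  refine eq_top_iff.2 (span_single_empty.symm.le.trans (Submodule.span_mono ?_))
  rintro _ ⟨z, rfl⟩
  intro z' J h
  by_cases hJ : IsPyramidVertex n m (moveAll (boxBase F.hn i t z').1 J)
  · rw [coord_single _ _ _ _ hJ] at h
    split_ifs at h with h'
    · rw [h'.2, Finset.card_empty, add_zero]
    · exact absurd rfl h
  · exact absurd (coord_of_not hJ _) h

end BoxModule

theorem PyramidFrame.isKoszulOfType (F : PyramidFrame (m := m) d) {q : ℕ} (hq : q + 1 = m) :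
    IsKoszulOfType (stableRelations (m := m) d) (n + 1) q := by
  refine ⟨F.degreePart_eq_bot, fun i => ⟨BoxModule.resolution F i,
    BoxModule.isMinimalResolution hq, fun t _ => BoxModule.span_deg t, fun q' hq' x hx => ?_⟩⟩
  obtain rfl : q = q' := by exact_mod_cast hq'
  exact BoxModule.kernel_last hq hx

end Koszul

end

theorem mainTheorem7 {k : Type u} [Field k] (n m : ℕ) (hn : 1 ≤ n) (hm : 3 ≤ m)
    (d : Fin (n + 1) → Fin (n + 1) → (Fin n → ℤ) → k) (hd : IsPyramidTwist n m d) :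
    ∃ (P I : Set (PyramidVertex n m)) (τ : (Pᶜ : Set (PyramidVertex n m)) ≃ (Iᶜ : Set _)),
      IsTranslationAlgebra n (stableRelations (m := m) d) P I τ ∧
      P = ∅ ∧ I = ∅ ∧ ∀ x, (τ x : PyramidVertex n m) = x := by
  obtain ⟨F⟩ := nonempty_pyramidFrame hn hm hd
  exact ⟨∅, ∅, Equiv.refl _,
    -- The resolution stops at step `m - 1`, the number of tokens.
    ⟨F.isTranslationQuiver, ((m - 1 : ℕ) : ℕ∞), F.isKoszulOfType (by omega)⟩, rfl, rfl,
    fun _ => rfl⟩
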